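/- Let $d\ge 1$ and let $(X_1,Y_1),(X_2,Y_2),\dotsc$ and $(X,Y)$ be iid random pairs with values in $\mathbb{R}^d\times[0,1]$. Assume that the distribution $\mu$ of $X$ is the uniform distribution on a full-dimensional simple polytope $K\subset\mathbb{R}^d$ (the convex hull of finitely many points, with nonempty interior, each vertex of which lies in exactly $d$ facets). Let $\eta(x)=\mathbb{E}(Y\mid X=x)$ and $v(x)=\operatorname{var}(Y\mid X=x)$, and assume that there are $A,A'\ge 0$ and $\alpha,\alpha'>0$ such that for all $x,x'\in K$ \[ |\eta(x)-\eta(x')|\le A\|x-x'\|^{\alpha},\qquad |v(x)-v(x')|\le A'\|x-x'\|^{\alpha'} . \] Let $T$ be a scheme that assigns to every finite family of points $x_1,\dotsc,x_n$ that affinely spans $\mathbb{R}^d$ a Delaunay triangulation of it, that is, a set of non-degenerate $d$-simplices with vertices among the $x_i$ which cover $\operatorname{conv}(x_1,\dotsc,x_n)$, any two of which intersect in the (possibly empty) face spanned by their common vertices, and such that the open ball bounded by the circumscribed sphere of each simplex contains none of the $x_i$. Let $\hat\eta=\hat\eta_n$ be the simplicial interpolant of $(X_1,Y_1),\dotsc,(X_n,Y_n)$: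 for $x$ in the convex hull $\hat C$ of $X_1,\dotsc,X_n$, $\hat\eta(x)=\beta_0+x^{\top}\beta$, where $(\beta_0,\beta)$ is the unique solution of $\beta_0+X_i^{\top}\beta=Y_i$ for the $d+1$ vertices $X_i$ of a simplex of the triangulation $T$ of $X_1,\dotsc,X_n$ that contains $x$; and $\hat\eta(x)=1/2$ for $x\notin\hat C$. (If $n>d$, the points $X_1,\dotsc,X_n$ almost surely span $\mathbb{R}^d$.) Then, for every $n>d$, $(\hat\eta(X)-\eta(X))^2$ is integrable, and \[ \limsup_{n\to\infty}\mathbb{E}\bigl[(\hat\eta(X)-\eta(X))^2\bigr]\le\frac{2}{d+2}\,\mathbb{E}\bigl[(Y-\eta(X))^2\bigr], \] where the expectation on the left is over both the training data and the test example. -/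

import Mathlib

open MeasureTheory ProbabilityTheory Filter Set
open scoped NNReal ENNReal

namespace SimplicialInterpolation

/-- `F` is a facet of the full-dimensional polytope `K ⊆ ℝ^d`: a nonempty face (cut out by a
supporting hyperplane) whose affine dimension is `d - 1`. -/
def IsFacet {d : ℕ} (K F : Set (EuclideanSpace ℝ (Fin d))) : Prop :=
  F.Nonempty ∧ IsExposed ℝ K F ∧ Module.finrank ℝ (vectorSpan ℝ F) + 1 = d

/-- `K` is a full-dimensional simple polytope in `ℝ^d`: the convex hull of finitely many points,
with nonempty interior, each of whose vertices lies in exactly `d` facets. -/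
structure IsSimplePolytope {d : ℕ} (K : Set (EuclideanSpace ℝ (Fin d))) : Prop where
  isPolytope : ∃ V : Finset (EuclideanSpace ℝ (Fin d)),
    K = convexHull ℝ (V : Set (EuclideanSpace ℝ (Fin d)))
  interior_nonempty : (interior K).Nonempty
  simple : ∀ v ∈ extremePoints ℝ K,
    {F : Set (EuclideanSpace ℝ (Fin d)) | IsFacet K F ∧ v ∈ F}.encard = d

/-- The geometric simplex spanned by the points `x i`, `i ∈ s`. -/
def cell {d n : ℕ} (x : Fin n → EuclideanSpace ℝ (Fin d)) (s : Finset (Fin n)) :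
    Set (EuclideanSpace ℝ (Fin d)) :=
  convexHull ℝ (x '' (s : Set (Fin n)))

/-- `T` is a triangulation of the points `x 0, …, x (n-1)` in `ℝ^d`. A simplex is recorded by
the set of indices of its vertices. The simplices are non-degenerate `d`-simplices, they cover the
convex hull of the points, and two of them meet exactly in the face spanned by their common
vertices. -/
structure IsTriangulation {d n : ℕ} (x : Fin n → EuclideanSpace ℝ (Fin d))
    (T : Set (Finset (Fin n))) : Prop where
  card_eq : ∀ s ∈ T, s.card = d + 1
  nondegenerate : ∀ s ∈ T, AffineIndependent ℝ (fun i : s => x i)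
  cover : ⋃ s ∈ T, cell x s = convexHull ℝ (range x)
  inter : ∀ s ∈ T, ∀ t ∈ T, cell x s ∩ cell x t = cell x (s ∩ t)

/-- A Delaunay triangulation: the open ball bounded by the circumscribed sphere of any simplex
contains none of the points. -/
structure IsDelaunayTriangulation {d n : ℕ} (x : Fin n → EuclideanSpace ℝ (Fin d))
    (T : Set (Finset (Fin n))) : Prop extends IsTriangulation x T where
  empty_circumball : ∀ s ∈ T, ∃ (c : EuclideanSpace ℝ (Fin d)) (r : ℝ),
    (∀ i ∈ s, dist (x i) c = r) ∧ ∀ j, r ≤ dist (x j) c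

open Classical in
/-- The linear (affine) interpolation at `z` of the labeled points `(x i, y i)`, `i ∈ s`: the value
`β₀ + ⟨z, β⟩`, where `β₀ + ⟨x i, β⟩ = y i` for all `i ∈ s`. For a non-degenerate `d`-simplex the
solution `(β₀, β)` exists and is unique. -/
noncomputable def linearInterpolation {d n : ℕ} (x : Fin n → EuclideanSpace ℝ (Fin d))
    (y : Fin n → ℝ) (s : Finset (Fin n)) (z : EuclideanSpace ℝ (Fin d)) : ℝ :=
  if h : ∃ β : ℝ × EuclideanSpace ℝ (Fin d), ∀ i ∈ s, β.1 + inner ℝ (x i) β.2 = y i then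
    h.choose.1 + inner ℝ z h.choose.2
  else 0

open Classical in
/-- The simplicial interpolant of the labeled points `(x i, y i)` with respect to `T`: at a point
`z` of some simplex of `T`, the linear interpolation at `z` of the labels at the vertices of such a
simplex; `1 / 2` at all other points (those outside the convex hull of the points, if `T` is a
triangulation). -/
noncomputable def simplicialInterpolant {d n : ℕ} (T : Set (Finset (Fin n)))
    (x : Fin n → EuclideanSpace ℝ (Fin d)) (y : Fin n → ℝ)
    (z : EuclideanSpace ℝ (Fin d)) : ℝ :=
  if h : ∃ s ∈ T, z ∈ cell x s then linearInterpolation x y h.choose z else 1 / 2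

/-- The estimator `η̂` built from the random examples `(X i ω, Y i ω)`, `i < n`, with the
triangulation scheme `T`, which sees only the unlabeled points. -/
noncomputable def etaHat {d : ℕ} {Ω : Type*}
    (T : ∀ n : ℕ, (Fin n → EuclideanSpace ℝ (Fin d)) → Set (Finset (Fin n)))
    (X : ℕ → Ω → EuclideanSpace ℝ (Fin d)) (Y : ℕ → Ω → ℝ) (n : ℕ) (ω : Ω)
    (z : EuclideanSpace ℝ (Fin d)) : ℝ :=
  simplicialInterpolant (T n fun i : Fin n => X i ω) (fun i : Fin n => X i ω)
    (fun i : Fin n => Y i ω) z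

end SimplicialInterpolation

/-! Write the interpolant at `z` as `∑ i, w i z * Y i`, where the weights `w i z` are the
barycentric coordinates of `z` in its Delaunay cell. For points in general position the weights are
determined by `z` alone: if two circumscribed spheres are empty, compare the powers of the points
with respect to both. The error `η̂ - η` splits into the interpolated noise
`∑ i, w i z * (Y i - η (X i))` and a bias, which tends to zero because the cells shrink where the
sample becomes dense.

The noise terms are uncorrelated, so the second moment of the interpolated noise is
`∑ i, 𝔼[w i (X)² * v (X i)]`. The homothety with center `X i` and ratio `1 - t` maps a cell with
vertex `X i` into itself and replaces `w i` by `t + (1 - t) * w i`. Hence `{w i > t}` is a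
homothetic copy of `{w i > 0}`, with volume smaller by the factor `(1 - t) ^ d`, and integrating
over `t` gives `∫ (w i)² = 2 / (d + 2) * ∫ w i`. The second moment is therefore
`2 / (d + 2) * 𝔼[∑ i, w i (X) * v (X i)]`, which tends to `2 / (d + 2) * 𝔼[v (X)]`.
-/

namespace SimplicialInterpolation

open Topology Module EuclideanGeometry

section DelaunayWeight

variable {ι E : Type*} [Fintype ι] [NormedAddCommGroup E] [InnerProductSpace ℝ E]
  {x : ι → E} {z : E} {w w' : ι → ℝ}

/-- `w` is a vector of barycentric coordinates of `z` with respect to points among the `x i` that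
lie on a sphere with none of the `x j` in its open ball. The coordinates are indexed by all the
points, so that no simplex has to be chosen. -/
structure IsDelaunayWeight (x : ι → E) (z : E) (w : ι → ℝ) : Prop where
  mem_stdSimplex : w ∈ stdSimplex ℝ ι
  sum_smul_eq : ∑ i, w i • x i = z
  exists_empty_sphere : ∃ S : Sphere E, (∀ j, S.radius ≤ dist (x j) S.center) ∧
    ∀ i, w i ≠ 0 → x i ∈ S

/-- General position for Delaunay triangulations in dimension `m = finrank ℝ E`: at most `m + 1` of
the points are always affinely independent, and no `m + 2` of them are cospherical. -/
structure GeneralPosition (x : ι → E) : Prop where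
  affineIndependent : ∀ s : Finset ι, s.card ≤ finrank ℝ E + 1 →
    AffineIndependent ℝ fun i : s => x i
  card_le_of_cospherical : ∀ s : Finset ι, Cospherical (x '' s) → s.card ≤ finrank ℝ E + 1

open Classical in
/-- The Delaunay weights of `z`, set to zero if they do not exist or are not unique: this
convention makes them measurable without any assumption on the points. -/
noncomputable def delaunayWeight (x : ι → E) (z : E) : ι → ℝ :=
  if h : ∃! w, IsDelaunayWeight x z w then h.choose else 0

omit [InnerProductSpace ℝ E] in
theorem radius_nonneg_of_mem_stdSimplex (hw : w ∈ stdSimplex ℝ ι) {S : Sphere E}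
    (hS : ∀ i, w i ≠ 0 → x i ∈ S) : 0 ≤ S.radius := by
  obtain ⟨i, -, hi⟩ : ∃ i ∈ Finset.univ, w i ≠ 0 :=
    Finset.exists_ne_zero_of_sum_ne_zero (hw.2 ▸ one_ne_zero)
  exact Sphere.radius_nonneg_of_mem (hS i hi)

theorem sum_mul_power_sub_power (hw : ∑ i, w i = 1) (S S' : Sphere E) :
    ∑ i, w i * (S.power (x i) - S'.power (x i)) =
      S.power (∑ i, w i • x i) - S'.power (∑ i, w i • x i) := by
  set c := ‖S.center‖ ^ 2 - S.radius ^ 2 - ‖S'.center‖ ^ 2 + S'.radius ^ 2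
  have affine (y : E) :
      S.power y - S'.power y = 2 * inner ℝ y (S'.center - S.center) + c := by
    rw [Sphere.power, Sphere.power, dist_eq_norm, dist_eq_norm, norm_sub_sq_real,
      norm_sub_sq_real, inner_sub_right]
    ring
  simp only [affine, sum_inner, real_inner_smul_left, mul_add, Finset.sum_add_distrib,
    ← Finset.sum_mul, hw, one_mul, Finset.mul_sum, mul_left_comm]

/-- Averaging the difference of the powers with respect to the two spheres, which is affine, over
both weights gives the same value, but the first average is nonpositive and the second one is
nonnegative. -/
theorem mem_sphere_of_isDelaunayWeight (hw : IsDelaunayWeight x z w)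
    (hw' : w' ∈ stdSimplex ℝ ι) (hz : ∑ i, w' i • x i = z) {S' : Sphere E}
    (hempty' : ∀ j, S'.radius ≤ dist (x j) S'.center) (hS' : ∀ i, w' i ≠ 0 → x i ∈ S')
    {i : ι} (hi : w i ≠ 0) : x i ∈ S' := by
  obtain ⟨hs, rfl, S, hempty, hS⟩ := hw
  have hr := radius_nonneg_of_mem_stdSimplex hs hS
  have hr' := radius_nonneg_of_mem_stdSimplex hw' hS'
  have power_zero : ∀ i, w i * S.power (x i) = 0 := fun i => by
    by_cases h : w i = 0
    · rw [h, zero_mul]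
    · rw [(Sphere.power_eq_zero_iff_mem_sphere hr).2 (hS i h), mul_zero]
  have power_zero' : ∀ i, w' i * S'.power (x i) = 0 := fun i => by
    by_cases h : w' i = 0
    · rw [h, zero_mul]
    · rw [(Sphere.power_eq_zero_iff_mem_sphere hr').2 (hS' i h), mul_zero]
  have power_nonneg : 0 ≤ ∑ i, w' i * S.power (x i) := Finset.sum_nonneg fun i _ =>
    mul_nonneg (hw'.1 i) ((Sphere.power_nonneg_iff_radius_le_dist_center hr).2 (hempty i))
  have power_nonneg' : ∀ i ∈ Finset.univ, 0 ≤ w i * S'.power (x i) := fun i _ =>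
    mul_nonneg (hs.1 i) ((Sphere.power_nonneg_iff_radius_le_dist_center hr').2 (hempty' i))
  have averages := (sum_mul_power_sub_power hs.2 S S').trans
    (hz ▸ sum_mul_power_sub_power (x := x) hw'.2 S S').symm
  simp only [mul_sub, power_zero, power_zero', zero_sub, sub_zero, Finset.sum_neg_distrib]
    at averages
  have sum_zero : ∑ i, w i * S'.power (x i) = 0 :=
    le_antisymm (by linarith) (Finset.sum_nonneg power_nonneg')
  have := (Finset.sum_eq_zero_iff_of_nonneg power_nonneg').1 sum_zero i (Finset.mem_univ i)
  exact (Sphere.power_eq_zero_iff_mem_sphere hr').1 ((mul_eq_zero.1 this).resolve_left hi)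

theorem eq_of_sum_smul_eq_of_affineIndependent {s : Finset ι}
    (hs : AffineIndependent ℝ fun i : s => x i) (hw : ∀ i ∉ s, w i = 0) (hw' : ∀ i ∉ s, w' i = 0)
    (hsum : ∑ i, w i = ∑ i, w' i) (hsmul : ∑ i, w i • x i = ∑ i, w' i • x i) : w = w' := by
  funext i
  by_cases hi : i ∈ s
  · refine sub_eq_zero.1 (affineIndependent_iff.1 hs Finset.univ (fun i => w i - w' i) ?_ ?_
      ⟨i, hi⟩ (Finset.mem_univ _))
    · rw [Finset.sum_coe_sort s fun i => w i - w' i,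
        Finset.sum_subset (Finset.subset_univ s) fun i _ hi => by rw [hw i hi, hw' i hi, sub_zero],
        Finset.sum_sub_distrib, hsum, sub_self]
    · rw [Finset.sum_coe_sort s fun i => (w i - w' i) • x i,
        Finset.sum_subset (Finset.subset_univ s) fun i _ hi => by
          rw [hw i hi, hw' i hi, sub_zero, zero_smul]]
      simp only [sub_smul, Finset.sum_sub_distrib, hsmul, sub_self]
  · rw [hw i hi, hw' i hi]

theorem GeneralPosition.isDelaunayWeight_unique (hx : GeneralPosition x)
    (hw : IsDelaunayWeight x z w) (hw' : IsDelaunayWeight x z w') : w = w' := by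
  classical
  obtain ⟨S, hempty, hS⟩ := hw'.exists_empty_sphere
  have hcard : (Finset.univ.filter fun i => x i ∈ S).card ≤ finrank ℝ E + 1 :=
    hx.card_le_of_cospherical _ ⟨S.center, S.radius, by simp⟩
  refine eq_of_sum_smul_eq_of_affineIndependent (hx.affineIndependent _ hcard) ?_ ?_
    (hw.mem_stdSimplex.2.trans hw'.mem_stdSimplex.2.symm)
    (hw.sum_smul_eq.trans hw'.sum_smul_eq.symm)
  · intro i hi
    contrapose! hi
    simpa using mem_sphere_of_isDelaunayWeight hw hw'.mem_stdSimplex hw'.sum_smul_eq hempty hS hi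
  · intro i hi
    contrapose! hi
    simpa using hS i hi

theorem GeneralPosition.delaunayWeight_eq (hx : GeneralPosition x)
    (hw : IsDelaunayWeight x z w) : delaunayWeight x z = w := by
  have h : ∃! w, IsDelaunayWeight x z w :=
    ⟨w, hw, fun _ hw' => hx.isDelaunayWeight_unique hw' hw⟩
  rw [delaunayWeight, dif_pos h]
  exact h.unique h.choose_spec.1 hw

theorem isDelaunayWeight_or_eq_zero :
    IsDelaunayWeight x z (delaunayWeight x z) ∨ delaunayWeight x z = 0 := by
  by_cases h : ∃! w, IsDelaunayWeight x z w
  · rw [delaunayWeight, dif_pos h]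
    exact .inl h.choose_spec.1
  · exact .inr (dif_neg h)

theorem isDelaunayWeight_of_delaunayWeight_ne_zero {i : ι} (hi : delaunayWeight x z i ≠ 0) :
    IsDelaunayWeight x z (delaunayWeight x z) :=
  isDelaunayWeight_or_eq_zero.resolve_right fun h => hi (congrFun h i)

theorem delaunayWeight_nonneg (i : ι) : 0 ≤ delaunayWeight x z i := by
  rcases isDelaunayWeight_or_eq_zero (x := x) (z := z) with h | h
  · exact h.mem_stdSimplex.1 i
  · rw [h, Pi.zero_apply]

theorem sum_delaunayWeight_le_one : ∑ i, delaunayWeight x z i ≤ 1 := by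
  rcases isDelaunayWeight_or_eq_zero (x := x) (z := z) with h | h
  · exact h.mem_stdSimplex.2.le
  · simp [h]

theorem delaunayWeight_le_one (i : ι) : delaunayWeight x z i ≤ 1 :=
  (Finset.single_le_sum (fun j _ => delaunayWeight_nonneg j) (Finset.mem_univ i)).trans
    sum_delaunayWeight_le_one

theorem IsDelaunayWeight.mem_convexHull (hw : IsDelaunayWeight x z w) :
    z ∈ convexHull ℝ (range x) := by
  rw [← hw.sum_smul_eq]
  exact (convex_convexHull ℝ _).sum_mem (fun i _ => hw.mem_stdSimplex.1 i) hw.mem_stdSimplex.2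
    fun i _ => subset_convexHull ℝ _ (mem_range_self i)

end DelaunayWeight

section SimplicialInterpolant

theorem exists_affine_interpolation {ι E : Type*} [NormedAddCommGroup E] [InnerProductSpace ℝ E]
    [FiniteDimensional ℝ E] {x : ι → E} (hx : AffineIndependent ℝ x) (y : ι → ℝ) :
    ∃ β : ℝ × E, ∀ i, β.1 + inner ℝ (x i) β.2 = y i := by
  have lift_independent : LinearIndependent ℝ fun i => ((1 : ℝ), x i) := by
    rw [linearIndependent_iff']
    intro s g hg i hi
    have h₁ := congrArg Prod.fst hg
    have h₂ := congrArg Prod.snd hg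
    simp only [Prod.fst_sum, Prod.snd_sum, Prod.smul_fst, Prod.smul_snd, Prod.fst_zero,
      Prod.snd_zero, smul_eq_mul, mul_one] at h₁ h₂
    exact affineIndependent_iff.1 hx s g h₁ h₂ i hi
  obtain ⟨g, hg⟩ := LinearMap.exists_extend ((Basis.span lift_independent).constr ℝ y)
  have hgx (i : ι) : g (1, x i) = y i := by
    have := LinearMap.congr_fun hg (Basis.span lift_independent i)
    rwa [LinearMap.comp_apply, Submodule.subtype_apply, Basis.constr_basis, Basis.span_apply]
      at this
  refine ⟨(g (1, 0), (InnerProductSpace.toDual ℝ E).symm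
    (LinearMap.toContinuousLinearMap (g ∘ₗ LinearMap.inr ℝ ℝ E))), fun i => ?_⟩
  rw [real_inner_comm, InnerProductSpace.toDual_symm_apply, ← hgx i]
  simp [← map_add]

variable {d n : ℕ} {x : Fin n → EuclideanSpace ℝ (Fin d)} {z : EuclideanSpace ℝ (Fin d)}
  {w : Fin n → ℝ}

theorem exists_mem_stdSimplex_of_mem_cell {s : Finset (Fin n)} (hz : z ∈ cell x s) :
    ∃ w ∈ stdSimplex ℝ (Fin n), (∀ i ∉ s, w i = 0) ∧ ∑ i, w i • x i = z := by
  classical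
  set W : Set (Fin n → ℝ) := stdSimplex ℝ (Fin n) ∩ {w | ∀ i ∉ s, w i = 0}
  have hW : Convex ℝ W := (convex_stdSimplex ℝ _).inter fun w hw w' hw' a b _ _ _ i hi => by
    simp [hw i hi, hw' i hi]
  have hcell : cell x s ⊆ Fintype.linearCombination ℝ x '' W := by
    refine convexHull_min ?_ (hW.linear_image _)
    rintro _ ⟨i, hi, rfl⟩
    refine ⟨Pi.single i 1, ⟨single_mem_stdSimplex ℝ i, fun j hj => ?_⟩, by simp⟩
    exact Pi.single_eq_of_ne (fun h => hj (by rwa [h])) 1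
  obtain ⟨w, ⟨hw, hws⟩, rfl⟩ := hcell hz
  exact ⟨w, hw, hws, (Fintype.linearCombination_apply ℝ x w).symm⟩

theorem linearInterpolation_eq_sum {s : Finset (Fin n)} {y : Fin n → ℝ}
    (hs : AffineIndependent ℝ fun i : s => x i) (hws : ∀ i ∉ s, w i = 0) (hw : ∑ i, w i = 1) :
    linearInterpolation x y s (∑ i, w i • x i) = ∑ i, w i * y i := by
  obtain ⟨γ, hγ⟩ := exists_affine_interpolation hs fun i => y i
  have hex : ∃ β : ℝ × EuclideanSpace ℝ (Fin d), ∀ i ∈ s, β.1 + inner ℝ (x i) β.2 = y i :=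
    ⟨γ, fun i hi => hγ ⟨i, hi⟩⟩
  rw [linearInterpolation, dif_pos hex]
  have hβ := hex.choose_spec
  generalize hex.choose = β at hβ
  calc β.1 + inner ℝ (∑ i, w i • x i) β.2 = ∑ i, w i * (β.1 + inner ℝ (x i) β.2) := by
        simp only [sum_inner, real_inner_smul_left, mul_add, Finset.sum_add_distrib,
          ← Finset.sum_mul, hw, one_mul]
    _ = ∑ i, w i * y i := Finset.sum_congr rfl fun i _ => by
        by_cases hi : i ∈ s
        · rw [hβ i hi]
        · rw [hws i hi, zero_mul, zero_mul]

variable {T : Set (Finset (Fin n))}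

theorem IsDelaunayTriangulation.isDelaunayWeight (hT : IsDelaunayTriangulation x T)
    {s : Finset (Fin n)} (hs : s ∈ T) (hw : w ∈ stdSimplex ℝ (Fin n)) (hws : ∀ i ∉ s, w i = 0) :
    IsDelaunayWeight x (∑ i, w i • x i) w := by
  obtain ⟨c, r, hsphere, hempty⟩ := hT.empty_circumball s hs
  exact ⟨hw, rfl, ⟨c, r⟩, hempty, fun i hi => hsphere i (not_imp_comm.1 (hws i) hi)⟩

theorem IsDelaunayTriangulation.exists_mem_cell (hT : IsDelaunayTriangulation x T)
    (hz : z ∈ convexHull ℝ (range x)) : ∃ s ∈ T, z ∈ cell x s := by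
  simpa only [← hT.cover, mem_iUnion, exists_prop] using hz

theorem IsDelaunayTriangulation.exists_isDelaunayWeight (hT : IsDelaunayTriangulation x T)
    (hz : z ∈ convexHull ℝ (range x)) : ∃ w, IsDelaunayWeight x z w := by
  obtain ⟨s, hs, hzs⟩ := hT.exists_mem_cell hz
  obtain ⟨w, hw, hws, rfl⟩ := exists_mem_stdSimplex_of_mem_cell hzs
  exact ⟨w, hT.isDelaunayWeight hs hw hws⟩

theorem IsDelaunayTriangulation.simplicialInterpolant_eq (hT : IsDelaunayTriangulation x T)
    (hx : GeneralPosition x) (y : Fin n → ℝ) :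
    simplicialInterpolant T x y z = ∑ i, delaunayWeight x z i * y i +
      1 / 2 * (1 - ∑ i, delaunayWeight x z i) := by
  by_cases h : ∃ s ∈ T, z ∈ cell x s
  · rw [simplicialInterpolant, dif_pos h]
    obtain ⟨hs, hzs⟩ := h.choose_spec
    obtain ⟨w, hw, hws, hwz⟩ := exists_mem_stdSimplex_of_mem_cell hzs
    subst hwz
    rw [linearInterpolation_eq_sum (hT.nondegenerate _ hs) hws hw.2,
      hx.delaunayWeight_eq (hT.isDelaunayWeight hs hw hws), hw.2, sub_self, mul_zero, add_zero]
  · have hzero : delaunayWeight x z = 0 := isDelaunayWeight_or_eq_zero.resolve_left fun hw =>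
      h (hT.exists_mem_cell hw.mem_convexHull)
    rw [simplicialInterpolant, dif_neg h]
    simp [hzero]

end SimplicialInterpolant

section SecondMoment

theorem lintegral_primitive_comp_of_measure_lt {α : Type*} [MeasurableSpace α] {μ : Measure α}
    {f : α → ℝ} {m : ℕ} (hfm : AEMeasurable f μ) (hf₀ : ∀ a, 0 ≤ f a) (hf₁ : ∀ a, f a ≤ 1)
    (hscale : ∀ t, 0 ≤ t → t < 1 →
      μ {a | t < f a} = ENNReal.ofReal ((1 - t) ^ m) * μ {a | 0 < f a})
    {g : ℝ → ℝ} (hg : Continuous g) (hg₀ : ∀ t, 0 ≤ t → 0 ≤ g t) :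
    ∫⁻ a, ENNReal.ofReal (∫ t in 0..f a, g t) ∂μ =
      ENNReal.ofReal (∫ t in (0 : ℝ)..1, (1 - t) ^ m * g t) * μ {a | 0 < f a} := by
  have hzero : Function.support (fun t => μ {a | t < f a} * ENNReal.ofReal (g t)) ⊆ Iio 1 := by
    refine Function.support_subset_iff'.2 fun t ht => ?_
    have : {a | t < f a} = ∅ := eq_empty_of_forall_notMem fun a ha =>
      ((hf₁ a).trans (not_lt.1 ht)).not_gt ha
    rw [this, measure_empty, zero_mul]
  have hnonneg : ∀ t ∈ Ioo (0 : ℝ) 1, 0 ≤ (1 - t) ^ m * g t := fun t ht =>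
    mul_nonneg (pow_nonneg (sub_nonneg.2 ht.2.le) m) (hg₀ t ht.1.le)
  rw [lintegral_comp_eq_lintegral_meas_lt_mul μ (ae_of_all _ hf₀) hfm
      (fun t _ => hg.intervalIntegrable _ _)
      ((ae_restrict_mem measurableSet_Ioi).mono fun t ht => hg₀ t (mem_Ioi.1 ht).le),
    ← setLIntegral_eq_of_support_subset hzero, Measure.restrict_restrict measurableSet_Iio,
    inter_comm, Ioi_inter_Iio, intervalIntegral.integral_of_le zero_le_one,
    integral_Ioc_eq_integral_Ioo, ofReal_integral_eq_lintegral_ofReal,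
    ← lintegral_mul_const _ (by fun_prop)]
  · refine setLIntegral_congr_fun measurableSet_Ioo fun t ht => ?_
    rw [hscale t ht.1.le ht.2, ENNReal.ofReal_mul (pow_nonneg (sub_nonneg.2 ht.2.le) m),
      mul_right_comm]
  · exact (Continuous.integrableOn_Icc (by fun_prop)).mono_set Ioo_subset_Icc_self
  · exact (ae_restrict_mem measurableSet_Ioo).mono hnonneg

theorem integral_one_sub_pow (m : ℕ) : ∫ t in (0 : ℝ)..1, (1 - t) ^ m = 1 / (m + 1) := by
  rw [intervalIntegral.integral_comp_sub_left fun t => t ^ m]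
  simp

theorem integral_one_sub_pow_mul_two_mul (m : ℕ) :
    ∫ t in (0 : ℝ)..1, (1 - t) ^ m * (2 * t) = 2 / ((m + 1) * (m + 2)) := by
  have expand (t : ℝ) : (1 - t) ^ m * (2 * t) = 2 * ((1 - t) ^ m - (1 - t) ^ (m + 1)) := by ring
  simp only [expand]
  rw [intervalIntegral.integral_const_mul, intervalIntegral.integral_sub
    (Continuous.intervalIntegrable (by fun_prop) _ _)
    (Continuous.intervalIntegrable (by fun_prop) _ _),
    integral_one_sub_pow, integral_one_sub_pow]
  push_cast
  field_simp
  ring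

theorem lintegral_sq_eq_of_measure_lt {α : Type*} [MeasurableSpace α] {μ : Measure α}
    {f : α → ℝ} {m : ℕ} (hfm : AEMeasurable f μ) (hf₀ : ∀ a, 0 ≤ f a) (hf₁ : ∀ a, f a ≤ 1)
    (hscale : ∀ t, 0 ≤ t → t < 1 →
      μ {a | t < f a} = ENNReal.ofReal ((1 - t) ^ m) * μ {a | 0 < f a}) :
    ∫⁻ a, ENNReal.ofReal (f a ^ 2) ∂μ =
      ENNReal.ofReal (2 / (m + 2)) * ∫⁻ a, ENNReal.ofReal (f a) ∂μ := by
  have first := lintegral_primitive_comp_of_measure_lt hfm hf₀ hf₁ hscale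
    (g := fun _ => 1) continuous_const fun _ _ => zero_le_one
  have second := lintegral_primitive_comp_of_measure_lt hfm hf₀ hf₁ hscale
    (g := fun t => 2 * t) (by fun_prop) fun t ht => mul_nonneg zero_le_two ht
  have primitive (y : ℝ) : ∫ t in 0..y, 2 * t = y ^ 2 := by
    rw [intervalIntegral.integral_const_mul, integral_id]
    ring
  simp only [intervalIntegral.integral_const, integral_one_sub_pow, smul_eq_mul, mul_one,
    sub_zero] at first
  simp only [primitive, integral_one_sub_pow_mul_two_mul] at second
  rw [first, second, ← mul_assoc, ← ENNReal.ofReal_mul (by positivity)]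
  congr 2
  field_simp

variable {ι E : Type*} [Fintype ι] [NormedAddCommGroup E] [InnerProductSpace ℝ E]
  {x : ι → E} {z : E} {w : ι → ℝ} {i : ι} {t : ℝ}

theorem IsDelaunayWeight.homothety [DecidableEq ι] {c : ℝ} (hw : IsDelaunayWeight x z w)
    (hi : w i ≠ 0) (hc : 0 ≤ c) (hci : 0 ≤ AffineMap.homothety (Pi.single i 1 : ι → ℝ) c w i) :
    IsDelaunayWeight x (AffineMap.homothety (x i) c z)
      (AffineMap.homothety (Pi.single i 1 : ι → ℝ) c w) := by
  obtain ⟨hs, rfl, S, hempty, hS⟩ := hw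
  refine ⟨⟨fun j => ?_, ?_⟩, ?_, S, hempty, fun j hj => ?_⟩
  · rcases eq_or_ne j i with rfl | hji
    · exact hci
    · simpa [AffineMap.homothety_apply, hji] using mul_nonneg hc (hs.1 j)
  · simp [AffineMap.homothety_apply, Finset.sum_add_distrib, ← Finset.mul_sum, hs.2]
  · simp [AffineMap.homothety_apply, add_smul, mul_smul, sub_smul, Finset.sum_add_distrib,
      ← Finset.smul_sum, Finset.sum_sub_distrib]
  · rcases eq_or_ne j i with rfl | hji
    · exact hS j hi
    · refine hS j fun h => hj ?_
      simp [AffineMap.homothety_apply, hji, h]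

theorem GeneralPosition.setOf_lt_delaunayWeight (hx : GeneralPosition x) (i : ι)
    (ht : 0 ≤ t) (ht' : t < 1) :
    {z | t < delaunayWeight x z i} =
      AffineMap.homothety (x i) (1 - t) '' {z | 0 < delaunayWeight x z i} := by
  classical
  have ht₁ : 0 < 1 - t := sub_pos.2 ht'
  have apply_self (c : ℝ) (w : ι → ℝ) :
      AffineMap.homothety (Pi.single i 1 : ι → ℝ) c w i = c * (w i - 1) + 1 := by
    simp [AffineMap.homothety_apply]
  refine subset_antisymm (fun z hz => ?_) ?_
  · have hzi : t < delaunayWeight x z i := hz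
    have hw := isDelaunayWeight_of_delaunayWeight_ne_zero (ht.trans_lt hzi).ne'
    have hpos :
        0 < AffineMap.homothety (Pi.single i 1 : ι → ℝ) (1 - t)⁻¹ (delaunayWeight x z) i := by
      have : (1 - t)⁻¹ * (delaunayWeight x z i - 1) + 1 =
        (1 - t)⁻¹ * (delaunayWeight x z i - t) := by field_simp; ring
      rw [apply_self, this]
      exact mul_pos (inv_pos.2 ht₁) (sub_pos.2 hzi)
    refine ⟨AffineMap.homothety (x i) (1 - t)⁻¹ z, ?_, ?_⟩
    · rwa [mem_ofPred_eq, hx.delaunayWeight_eq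
        (hw.homothety (ht.trans_lt hzi).ne' (inv_nonneg.2 ht₁.le) hpos.le)]
    · rw [← AffineMap.homothety_mul_apply, mul_inv_cancel₀ ht₁.ne', AffineMap.homothety_one,
        AffineMap.id_apply]
  · rintro _ ⟨z, hz, rfl⟩
    have hzi : 0 < delaunayWeight x z i := hz
    have hlt : t < AffineMap.homothety (Pi.single i 1 : ι → ℝ) (1 - t) (delaunayWeight x z) i := by
      rw [apply_self]
      nlinarith
    rwa [mem_ofPred_eq, hx.delaunayWeight_eq ((isDelaunayWeight_of_delaunayWeight_ne_zero
      hzi.ne').homothety hzi.ne' ht₁.le (ht.trans hlt.le))]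

theorem GeneralPosition.lintegral_sq_delaunayWeight [FiniteDimensional ℝ E] [MeasurableSpace E]
    [BorelSpace E] (μ : Measure E) [μ.IsAddHaarMeasure] (hx : GeneralPosition x) (i : ι)
    (hm : AEMeasurable (fun z => delaunayWeight x z i) μ) :
    ∫⁻ z, ENNReal.ofReal (delaunayWeight x z i ^ 2) ∂μ =
      ENNReal.ofReal (2 / (finrank ℝ E + 2)) * ∫⁻ z, ENNReal.ofReal (delaunayWeight x z i) ∂μ := by
  refine lintegral_sq_eq_of_measure_lt hm (fun _ => delaunayWeight_nonneg i)
    (fun _ => delaunayWeight_le_one i) fun t ht ht' => ?_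
  rw [hx.setOf_lt_delaunayWeight i ht ht', Measure.addHaar_image_homothety,
    abs_of_nonneg (pow_nonneg (sub_nonneg.2 ht'.le) _)]

end SecondMoment

section Convergence

variable {ι E : Type*} [Fintype ι]

theorem sum_smul_mem_of_convex {F : Type*} [AddCommGroup F] [Module ℝ F] {s : Set F}
    (hs : Convex ℝ s) {w : ι → ℝ} (hw : w ∈ stdSimplex ℝ ι) {y : ι → F}
    (hy : ∀ i, w i ≠ 0 → y i ∈ s) : ∑ i, w i • y i ∈ s := by
  rw [← finsum_eq_sum_of_fintype]
  exact hs.finsum_mem hw.1 (by rw [finsum_eq_sum_of_fintype, hw.2]) hy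

theorem exists_ball_subset_of_mem_closedBall [SeminormedAddCommGroup E] [NormedSpace ℝ E]
    {c p : E} {r ρ : ℝ} (hρ : 0 < ρ) (hr : ρ ≤ r) (hp : p ∈ Metric.closedBall c r) :
    ∃ q ∈ Metric.closedBall p ρ, Metric.ball q ρ ⊆ Metric.ball c r := by
  rw [Metric.mem_closedBall] at hp
  rcases le_or_gt (dist p c) ρ with h | h
  · exact ⟨c, by rwa [Metric.mem_closedBall, dist_comm], Metric.ball_subset_ball hr⟩
  · have hpc : 0 < dist p c := hρ.trans h
    have hle : ρ / dist p c ≤ 1 := (div_le_one hpc).2 h.le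
    refine ⟨AffineMap.lineMap p c (ρ / dist p c), ?_, Metric.ball_subset_ball' ?_⟩
    · rw [Metric.mem_closedBall, dist_lineMap_left, Real.norm_of_nonneg (by positivity),
        div_mul_cancel₀ _ hpc.ne']
    · rw [dist_lineMap_right, Real.norm_of_nonneg (by linarith), sub_mul,
        div_mul_cancel₀ _ hpc.ne']
      linarith

section InnerProductSpace

variable [NormedAddCommGroup E] [InnerProductSpace ℝ E] {x : ι → E} {z : E} {w : ι → ℝ} {ρ : ℝ}

/-- A circumscribed ball of radius at least `ρ` would contain a ball of radius `ρ` close to `z`,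
hence one of the points. -/
theorem IsDelaunayWeight.dist_lt (hw : IsDelaunayWeight x z w) (hρ : 0 < ρ)
    (hfill : ∀ q ∈ Metric.closedBall z ρ, ∃ j, x j ∈ Metric.ball q ρ) {i : ι} (hi : w i ≠ 0) :
    dist (x i) z < 2 * ρ := by
  obtain ⟨S, hempty, hS⟩ := hw.exists_empty_sphere
  have hz : z ∈ Metric.closedBall S.center S.radius := hw.sum_smul_eq ▸
    sum_smul_mem_of_convex (convex_closedBall _ _) hw.mem_stdSimplex fun i hi => (hS i hi).le
  have hr : S.radius < ρ := by
    by_contra! hr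
    obtain ⟨q, hq, hsub⟩ := exists_ball_subset_of_mem_closedBall hρ hr hz
    obtain ⟨j, hj⟩ := hfill q hq
    exact (hempty j).not_gt (hsub hj)
  calc dist (x i) z ≤ dist (x i) S.center + dist z S.center := dist_triangle_right _ _ _
    _ ≤ S.radius + S.radius := add_le_add (hS i hi).le hz
    _ < 2 * ρ := by linarith

omit [Fintype ι] in
theorem mem_convexHull_of_forall_mem_closedBall [Finite ι] [CompleteSpace E] (hρ : 0 < ρ)
    (hfill : ∀ q ∈ Metric.closedBall z ρ, ∃ j, x j ∈ Metric.ball q ρ) :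
    z ∈ convexHull ℝ (range x) := by
  by_contra hz
  obtain ⟨f, u, hfu, hu⟩ := geometric_hahn_banach_closed_point (convex_convexHull ℝ (range x))
    ((finite_range x).isClosed_convexHull ℝ) hz
  obtain ⟨a, rfl⟩ := (InnerProductSpace.toDual ℝ E).surjective f
  simp only [InnerProductSpace.toDual_apply_apply] at hfu hu
  have separated (j : ι) : inner ℝ a (x j) < inner ℝ a z :=
    (hfu (x j) (subset_convexHull ℝ _ (mem_range_self j))).trans hu
  have ha : 0 < ‖a‖ := norm_pos_iff.2 fun h => by
    obtain ⟨j, -⟩ := hfill z (Metric.mem_closedBall_self hρ.le)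
    simpa [h] using separated j
  obtain ⟨j, hj⟩ := hfill (z + (ρ / ‖a‖) • a) (by
    rw [Metric.mem_closedBall, dist_self_add_left, norm_smul, Real.norm_of_nonneg (by positivity),
      div_mul_cancel₀ _ ha.ne'])
  have hlt : ‖a‖ * ρ < ‖a‖ * dist (x j) (z + (ρ / ‖a‖) • a) := by
    calc ‖a‖ * ρ = inner ℝ a ((z + (ρ / ‖a‖) • a) - z) := by
          rw [add_sub_cancel_left, inner_smul_right, real_inner_self_eq_norm_sq]
          field_simp
      _ < inner ℝ a ((z + (ρ / ‖a‖) • a) - x j) := by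
          simp only [inner_sub_right]
          linarith [separated j]
      _ ≤ ‖a‖ * dist (x j) (z + (ρ / ‖a‖) • a) := by
          rw [dist_comm, dist_eq_norm]
          exact real_inner_le_norm _ _
  exact (lt_of_mul_lt_mul_left hlt ha.le).not_gt hj

end InnerProductSpace

theorem eventually_forall_exists_mem_ball_of_subset_closure_range {α : Type*}
    [PseudoMetricSpace α] {s : Set α} (hs : IsCompact s) {p : ℕ → α} (hp : s ⊆ closure (range p))
    {ρ : ℝ} (hρ : 0 < ρ) :
    ∀ᶠ n in atTop, ∀ q ∈ s, ∃ j : Fin n, p j ∈ Metric.ball q ρ := by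
  have hcover : s ⊆ ⋃ i, Metric.ball (p i) ρ := fun q hq => by
    obtain ⟨_, ⟨i, rfl⟩, hi⟩ := Metric.mem_closure_iff.1 (hp hq) ρ hρ
    exact mem_iUnion.2 ⟨i, hi⟩
  obtain ⟨t, ht⟩ := hs.elim_finite_subcover _ (fun _ => Metric.isOpen_ball) hcover
  filter_upwards [eventually_gt_atTop (t.sup id)] with n hn q hq
  obtain ⟨i, hi, hqi⟩ := mem_iUnion₂.1 (ht hq)
  exact ⟨⟨i, (Finset.le_sup (f := id) hi).trans_lt hn⟩, Metric.mem_ball_comm.1 hqi⟩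

variable [NormedAddCommGroup E] [InnerProductSpace ℝ E] [FiniteDimensional ℝ E]

theorem tendsto_sum_delaunayWeight {p : ℕ → E} {z : E} (hz : closure (range p) ∈ 𝓝 z)
    (hw : ∀ᶠ n in atTop, z ∈ convexHull ℝ (range fun i : Fin n => p i) →
      IsDelaunayWeight (fun i : Fin n => p i) z (delaunayWeight (fun i : Fin n => p i) z))
    {g : E → ℝ} (hg : ContinuousAt g z) :
    Tendsto (fun n => ∑ i, delaunayWeight (fun i : Fin n => p i) z i * g (p i)) atTop
      (𝓝 (g z)) := by
  rw [Metric.tendsto_nhds]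
  intro ε hε
  obtain ⟨τ, hτ, hgτ⟩ := Metric.continuousAt_iff.1 hg (ε / 2) (half_pos hε)
  obtain ⟨δ, hδ, hpδ⟩ := Metric.nhds_basis_closedBall.mem_iff.1 hz
  set ρ := min δ (τ / 2)
  have hρ : 0 < ρ := lt_min hδ (half_pos hτ)
  filter_upwards [hw, eventually_forall_exists_mem_ball_of_subset_closure_range
    (isCompact_closedBall z ρ)
    ((Metric.closedBall_subset_closedBall (min_le_left _ _)).trans hpδ) hρ] with n hwn hfill
  have hD := hwn (mem_convexHull_of_forall_mem_closedBall hρ hfill)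
  refine lt_of_le_of_lt ?_ (half_lt_self hε)
  refine sum_smul_mem_of_convex (y := fun i : Fin n => g (p i))
    (convex_closedBall (g z) (ε / 2)) hD.mem_stdSimplex fun i hi => (hgτ ?_).le
  calc dist (p i) z < 2 * ρ := hD.dist_lt hρ hfill hi
    _ ≤ τ := by linarith [min_le_right δ (τ / 2)]

end Convergence

section MeasurableSelection

variable {α β : Type*} [MeasurableSpace α]

theorem measurableSet_exists_of_isClosed [TopologicalSpace α] [T2Space α] [BorelSpace α]
    [SigmaCompactSpace α] [TopologicalSpace β] [SigmaCompactSpace β] {S : Set (α × β)}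
    (hS : IsClosed S) : MeasurableSet {a | ∃ b, (a, b) ∈ S} := by
  have projection : {a | ∃ b, (a, b) ∈ S} = Prod.fst '' S := by ext; simp
  obtain ⟨k, hk, hkS⟩ :=
    (isSigmaCompact_univ.of_isClosed_subset hS (subset_univ S)).image continuous_fst
  rw [projection, ← hkS]
  exact MeasurableSet.iUnion fun i => (hk i).measurableSet

variable [PseudoEMetricSpace β] {R : α → β → Prop}

theorem measurableSet_exists_mem_of_isOpen
    (hR : ∀ C, IsClosed C → MeasurableSet {a | ∃ b ∈ C, R a b}) {U : Set β} (hU : IsOpen U) :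
    MeasurableSet {a | ∃ b ∈ U, R a b} := by
  obtain ⟨C, hC, -, hCU, -⟩ := hU.exists_iUnion_isClosed
  have : {a | ∃ b ∈ U, R a b} = ⋃ n, {a | ∃ b ∈ C n, R a b} := by
    ext a
    simp only [← hCU, mem_iUnion, mem_ofPred_eq]
    tauto
  exact this ▸ MeasurableSet.iUnion fun n => hR _ (hC n)

theorem measurableSet_existsUnique [SecondCountableTopology β] [T2Space β]
    (hR : ∀ C, IsClosed C → MeasurableSet {a | ∃ b ∈ C, R a b}) :
    MeasurableSet {a | ∃! b, R a b} := by
  set basis := TopologicalSpace.countableBasis β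
  have two_values : {a | ∃! b, R a b} = {a | ∃ b ∈ univ, R a b} \ ⋃ U ∈ basis, ⋃ V ∈ basis,
      ⋃ _ : Disjoint U V, {a | ∃ b ∈ U, R a b} ∩ {a | ∃ b ∈ V, R a b} := by
    ext a
    simp only [Set.mem_sdiff, mem_iUnion, mem_inter_iff, mem_ofPred_eq, not_exists, mem_univ,
      true_and]
    constructor
    · rintro ⟨b, hb, hunique⟩
      refine ⟨⟨b, hb⟩, ?_⟩
      rintro U - V - hUV ⟨⟨c, hcU, hc⟩, ⟨c', hcV, hc'⟩⟩
      exact hUV.ne_of_mem hcU hcV ((hunique c hc).trans (hunique c' hc').symm)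
    · rintro ⟨⟨b, hb⟩, hdisjoint⟩
      refine ⟨b, hb, fun c hc => by_contra fun hbc => ?_⟩
      obtain ⟨U', V', hU', hV', hcU', hbV', hUV'⟩ := t2_separation hbc
      have isBasis := TopologicalSpace.isBasis_countableBasis β
      obtain ⟨U, hU, hcU, hUU'⟩ := isBasis.exists_subset_of_mem_open hcU' hU'
      obtain ⟨V, hV, hbV, hVV'⟩ := isBasis.exists_subset_of_mem_open hbV' hV'
      exact hdisjoint U hU V hV (hUV'.mono hUU' hVV') ⟨⟨c, hcU, hc⟩, ⟨b, hbV, hb⟩⟩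
  have open_hit : ∀ U ∈ basis, MeasurableSet {a | ∃ b ∈ U, R a b} := fun U hU =>
    measurableSet_exists_mem_of_isOpen hR (TopologicalSpace.isOpen_of_mem_countableBasis hU)
  have countable := TopologicalSpace.countable_countableBasis β
  rw [two_values]
  exact (hR _ isClosed_univ).diff <| .biUnion countable fun U hU => .biUnion countable fun V hV =>
    .iUnion fun _ => (open_hit U hU).inter (open_hit V hV)

theorem measurable_of_existsUnique [SecondCountableTopology β] [T2Space β] [MeasurableSpace β]
    [BorelSpace β] (hR : ∀ C, IsClosed C → MeasurableSet {a | ∃ b ∈ C, R a b}) {f : α → β} {c : β}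
    (hf : ∀ a, (∃! b, R a b) → R a (f a)) (hc : ∀ a, (¬ ∃! b, R a b) → f a = c) :
    Measurable f := by
  refine measurable_of_isClosed fun C hC => ?_
  have hunique := measurableSet_existsUnique hR
  have preimage_eq : f ⁻¹' C = {a | ∃! b, R a b} ∩ {a | ∃ b ∈ C, R a b} ∪
      {a | ∃! b, R a b}ᶜ ∩ {_a | c ∈ C} := by
    ext a
    by_cases h : ∃! b, R a b
    · have : (∃ b ∈ C, R a b) ↔ f a ∈ C :=
        ⟨fun ⟨b, hbC, hb⟩ => h.unique hb (hf a h) ▸ hbC, fun hC => ⟨_, hC, hf a h⟩⟩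
      simp [h, this]
    · simp [h, hc a h]
  rw [preimage_eq]
  exact (hunique.inter (hR C hC)).union (hunique.compl.inter (.const _))

end MeasurableSelection

section Measurability

variable {ι E : Type*} [Fintype ι] [NormedAddCommGroup E] [InnerProductSpace ℝ E]

theorem exists_mem_isDelaunayWeight_iff {x : ι → E} {z : E} {C : Set (ι → ℝ)} :
    (∃ w ∈ C, IsDelaunayWeight x z w) ↔ ∃ q : (ι → ℝ) × E × ℝ,
      (q.1 ∈ C ∩ stdSimplex ℝ ι ∧ ∑ i, q.1 i • x i = z) ∧ (∀ j, q.2.2 ≤ dist (x j) q.2.1) ∧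
        ∀ i, q.1 i * (dist (x i) q.2.1 - q.2.2) = 0 := by
  constructor
  · rintro ⟨w, hC, hs, hz, S, hempty, hS⟩
    refine ⟨(w, S.center, S.radius), ⟨⟨hC, hs⟩, hz⟩, hempty, fun i => ?_⟩
    by_cases hi : w i = 0
    · simp [hi]
    · simp [mem_sphere.1 (hS i hi)]
  · rintro ⟨⟨w, c, r⟩, ⟨⟨hC, hs⟩, hz⟩, hempty, hS⟩
    exact ⟨w, hC, hs, hz, ⟨c, r⟩, hempty, fun i hi =>
      sub_eq_zero.1 ((mul_eq_zero.1 (hS i)).resolve_left hi)⟩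

variable [FiniteDimensional ℝ E] [MeasurableSpace E] [BorelSpace E]

theorem measurableSet_exists_mem_isDelaunayWeight {C : Set (ι → ℝ)} (hC : IsClosed C) :
    MeasurableSet {q : (ι → E) × E | ∃ w ∈ C, IsDelaunayWeight q.1 q.2 w} := by
  simp only [exists_mem_isDelaunayWeight_iff]
  refine measurableSet_exists_of_isClosed (S := {p : ((ι → E) × E) × (ι → ℝ) × E × ℝ |
    (p.2.1 ∈ C ∩ stdSimplex ℝ ι ∧ ∑ i, p.2.1 i • p.1.1 i = p.1.2) ∧
      (∀ j, p.2.2.2 ≤ dist (p.1.1 j) p.2.2.1) ∧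
        ∀ i, p.2.1 i * (dist (p.1.1 i) p.2.2.1 - p.2.2.2) = 0}) ?_
  simp only [Set.ofPred_and, Set.ofPred_forall]
  refine ((IsClosed.preimage (by fun_prop) (hC.inter (isClosed_stdSimplex ℝ ι))).inter
    (isClosed_eq (by fun_prop) (by fun_prop))).inter (.inter ?_ ?_)
  · exact isClosed_iInter fun j => isClosed_le (by fun_prop) (by fun_prop)
  · exact isClosed_iInter fun i => isClosed_eq (by fun_prop) (by fun_prop)

theorem measurable_delaunayWeight :
    Measurable fun q : (ι → E) × E => delaunayWeight q.1 q.2 :=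
  measurable_of_existsUnique (fun _ => measurableSet_exists_mem_isDelaunayWeight)
    (fun q h => by rw [delaunayWeight, dif_pos h]; exact h.choose_spec.1)
    fun q h => by rw [delaunayWeight, dif_neg h]

end Measurability

section ProductMeasure

variable {ι α : Type*} [Fintype ι] [DecidableEq ι] [MeasurableSpace α] (ν : Measure α)
  [IsProbabilityMeasure ν] (i : ι)

theorem measurePreserving_update :
    MeasurePreserving (fun q : (ι → α) × α => Function.update q.1 i q.2)
      ((Measure.pi fun _ => ν).prod ν) (Measure.pi fun _ => ν) := by
  refine ⟨measurable_update', (Measure.pi_eq fun s hs => ?_).symm⟩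
  have preimage_eq : (fun q : (ι → α) × α => Function.update q.1 i q.2) ⁻¹' univ.pi s =
      univ.pi (Function.update s i univ) ×ˢ s i := by
    ext q
    simp only [mem_preimage, mem_univ_pi, mem_prod]
    rw [Function.forall_update_iff q.1 fun j a => a ∈ s j,
      Function.forall_update_iff s fun j S => q.1 j ∈ S]
    simp only [mem_univ, true_and, and_comm]
  rw [Measure.map_apply measurable_update' (MeasurableSet.univ_pi hs), preimage_eq,
    Measure.prod_prod, Measure.pi_pi]
  simp only [Function.apply_update fun _ => ν, measure_univ]
  rw [Finset.prod_update_of_mem (Finset.mem_univ i), one_mul, mul_comm,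
    Finset.sdiff_singleton_eq_erase, Finset.mul_prod_erase _ (fun j => ν (s j)) (Finset.mem_univ i)]

variable {ν i}

theorem ae_pi_of_forall_ae_update {p : (ι → α) → Prop} (hp : MeasurableSet {x | p x})
    (h : ∀ x, ∀ᵐ a ∂ν, p (Function.update x i a)) : ∀ᵐ x ∂Measure.pi fun _ => ν, p x := by
  have hi := measurePreserving_update ν i
  rw [← hi.map_eq, ae_map_iff hi.aemeasurable hp]
  exact (Measure.ae_prod_iff_ae_ae (hi.measurable hp)).2 (.of_forall h)

end ProductMeasure

section GeneralPosition

variable {ι E : Type*} [NormedAddCommGroup E] [InnerProductSpace ℝ E] {x : ι → E} {s : Finset ι}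
  {i : ι}

theorem affineIndependent_insert [DecidableEq ι] (hs : AffineIndependent ℝ fun j : s => x j)
    (hi : x i ∉ affineSpan ℝ (range fun j : s => x j)) :
    AffineIndependent ℝ fun j : (insert i s : Finset ι) => x j := by
  let last : (insert i s : Finset ι) := ⟨i, Finset.mem_insert_self i s⟩
  have mem_of_ne (j : (insert i s : Finset ι)) (hj : j ≠ last) : ↑j ∈ s :=
    Finset.mem_of_mem_insert_of_ne j.2 fun h => hj (Subtype.ext h)
  let others : {j // j ≠ last} ↪ s :=
    ⟨fun j => ⟨j, mem_of_ne j j.2⟩, fun j k hjk => Subtype.ext (Subtype.ext (Subtype.mk.inj hjk))⟩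
  refine AffineIndependent.affineIndependent_of_notMem_span (i := last)
    (hs.comp_embedding others) fun h => hi (affineSpan_mono ℝ ?_ h)
  rintro _ ⟨j, hj, rfl⟩
  exact ⟨others ⟨j, hj⟩, rfl⟩

omit [NormedAddCommGroup E] [InnerProductSpace ℝ E] in
theorem restrict_update [DecidableEq ι] (hi : i ∉ s) (a : E) :
    (fun j : s => Function.update x i a j) = fun j : s => x j :=
  funext fun j => Function.update_of_ne (ne_of_mem_of_not_mem j.2 hi) a x

variable [FiniteDimensional ℝ E]

theorem affineSpan_range_eq_top_iff (hs : AffineIndependent ℝ fun j : s => x j) :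
    affineSpan ℝ (range fun j : s => x j) = ⊤ ↔ s.card = finrank ℝ E + 1 := by
  rw [hs.affineSpan_eq_top_iff_card_eq_finrank_add_one, Fintype.card_coe]

theorem GeneralPosition.affineSpan_eq_top [Fintype ι] (hx : GeneralPosition x)
    (hcard : finrank ℝ E < Fintype.card ι) : affineSpan ℝ (range x) = ⊤ := by
  obtain ⟨s, -, hs⟩ := Finset.exists_subset_card_eq (s := (Finset.univ : Finset ι)) hcard
  exact top_le_iff.1 <| ((affineSpan_range_eq_top_iff (hx.affineIndependent s hs.le)).2 hs).ge.trans
    (affineSpan_mono ℝ (range_comp_subset_range _ x))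

theorem exists_sphere_of_cospherical_image_insert [DecidableEq ι]
    (hs : AffineIndependent ℝ fun j : s => x j) (hcard : s.card = finrank ℝ E + 1) (hi : i ∉ s) :
    ∃ S : Sphere E, ∀ a,
      Cospherical (Function.update x i a '' (insert i s : Finset ι)) → a ∈ S := by
  have : Nonempty s := (Finset.card_pos.1 (by omega)).to_subtype
  obtain ⟨S, -, hS⟩ := hs.existsUnique_dist_eq
  refine ⟨S, fun a ⟨c, r, hc⟩ => ?_⟩
  rw [← hS ⟨c, r⟩ ⟨(affineSpan_range_eq_top_iff hs).2 hcard ▸ AffineSubspace.mem_top .., ?_⟩]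
  · exact hc a ⟨i, by simp, Function.update_self i a x⟩
  · rintro _ ⟨j, rfl⟩
    exact hc _ ⟨j, by simp, congrFun (restrict_update hi a) j⟩

variable [MeasurableSpace E] [BorelSpace E]

variable (E s) in
theorem measurableSet_affineIndependent [Finite ι] :
    MeasurableSet {x : ι → E | AffineIndependent ℝ fun i : s => x i} :=
  (isOpen_setOfPred_affineIndependent.preimage
    (f := fun (x : ι → E) (i : s) => x i) (by fun_prop)).measurableSet

variable (E s) in
theorem measurableSet_cospherical_image [Finite ι] :
    MeasurableSet {x : ι → E | Cospherical (x '' s)} := by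
  have exists_center_radius : {x : ι → E | Cospherical (x '' s)} =
      {x | ∃ q, (x, q) ∈ {p : (ι → E) × E × ℝ | ∀ i ∈ s, dist (p.1 i) p.2.1 = p.2.2}} := by
    ext x
    simp [Cospherical]
  rw [exists_center_radius]
  refine measurableSet_exists_of_isClosed ?_
  simp only [Set.ofPred_forall]
  exact isClosed_iInter fun i => isClosed_iInter fun _ => isClosed_eq (by fun_prop) (by fun_prop)

variable [Fintype ι] {μ ν : Measure E} [μ.IsAddHaarMeasure] [IsProbabilityMeasure ν]

theorem ae_affineIndependent (hν : ν ≪ μ) (hs : s.card ≤ finrank ℝ E + 1) :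
    ∀ᵐ x ∂Measure.pi fun _ : ι => ν, AffineIndependent ℝ fun i : s => x i := by
  classical
  induction s using Finset.induction with
  | empty => exact .of_forall fun x => affineIndependent_of_subsingleton ℝ _
  | insert i s hi ih =>
    rw [Finset.card_insert_of_notMem hi] at hs
    have insert_independent : ∀ᵐ x ∂Measure.pi fun _ : ι => ν,
        (AffineIndependent ℝ fun j : s => x j) →
          AffineIndependent ℝ fun j : (insert i s : Finset ι) => x j := by
      refine ae_pi_of_forall_ae_update (i := i)
        ((measurableSet_affineIndependent E s).imp (measurableSet_affineIndependent E _))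
        fun x => ?_
      simp only [restrict_update hi, eventually_imp_distrib_left]
      intro hx
      have span_ne_top := mt (affineSpan_range_eq_top_iff hx).1 (by omega)
      filter_upwards [measure_eq_zero_iff_ae_notMem.1
        (hν (Measure.addHaar_affineSubspace μ _ span_ne_top))] with a ha
      rw [← restrict_update hi a] at hx ha
      exact affineIndependent_insert hx (by rwa [Function.update_self])
    filter_upwards [insert_independent, ih (by omega)] with x hinsert hx using hinsert hx

theorem ae_not_cospherical_image_insert [DecidableEq ι] [Nontrivial E] (hν : ν ≪ μ)
    (hcard : s.card = finrank ℝ E + 1) (hi : i ∉ s) :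
    ∀ᵐ x ∂Measure.pi fun _ : ι => ν, (AffineIndependent ℝ fun j : s => x j) →
      ¬ Cospherical (x '' (insert i s : Finset ι)) := by
  refine ae_pi_of_forall_ae_update (i := i)
    ((measurableSet_affineIndependent E s).imp (measurableSet_cospherical_image E _).compl)
    fun x => ?_
  simp only [restrict_update hi, eventually_imp_distrib_left]
  intro hx
  obtain ⟨S, hS⟩ := exists_sphere_of_cospherical_image_insert hx hcard hi
  filter_upwards [measure_eq_zero_iff_ae_notMem.1
    (hν (Measure.addHaar_sphere μ S.center S.radius))] with a ha using fun h => ha (hS a h)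

theorem ae_generalPosition [Nontrivial E] (hν : ν ≪ μ) :
    ∀ᵐ x ∂Measure.pi fun _ : ι => ν, GeneralPosition x := by
  classical
  have independent : ∀ᵐ x ∂Measure.pi fun _ : ι => ν, ∀ s : Finset ι,
      s.card ≤ finrank ℝ E + 1 → AffineIndependent ℝ fun i : s => x i := by
    simp only [ae_all_iff]
    exact fun s => ae_affineIndependent hν
  have not_cospherical : ∀ᵐ x ∂Measure.pi fun _ : ι => ν, ∀ s : Finset ι,
      s.card = finrank ℝ E + 1 → ∀ i ∉ s, (AffineIndependent ℝ fun j : s => x j) →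
        ¬ Cospherical (x '' (insert i s : Finset ι)) := by
    simp only [ae_all_iff]
    exact fun s hs i => ae_not_cospherical_image_insert hν hs
  filter_upwards [independent, not_cospherical] with x hind hcosph
  refine ⟨hind, fun s hs => ?_⟩
  by_contra! hcard
  obtain ⟨t, hts, ht⟩ := Finset.exists_subset_card_eq hcard.le
  obtain ⟨i, hi, hit⟩ := Finset.exists_mem_notMem_of_card_lt_card (ht ▸ hcard)
  exact hcosph t ht i hit (hind t ht.le)
    (hs.subset (image_mono (Finset.coe_subset.2 (Finset.insert_subset hi hts))))

end GeneralPosition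

section RegressionModel

variable {β : Type*} [MeasurableSpace β]

/-- `ν` is the distribution of a bounded example `(x, y)` with conditional mean `η x` and
conditional variance `v x` of `y` given `x`. The conditional expectations are expressed through
bounded test functions of `x`. -/
structure IsRegressionModel (ν : Measure (β × ℝ)) (η v : β → ℝ) : Prop where
  measurable_mean : Measurable η
  measurable_variance : Measurable v
  exists_bound : ∃ M : ℝ≥0, ∀ᵐ a ∂ν, |η a.1| ≤ M ∧ |a.2 - η a.1| ≤ M ∧ |v a.1| ≤ M
  integral_mul_noise (h : β → ℝ) (hm : Measurable h) (hb : ∃ C, ∀ b, |h b| ≤ C) :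
    ∫ a, h a.1 * (a.2 - η a.1) ∂ν = 0
  integral_mul_noise_sq (h : β → ℝ) (hm : Measurable h) (hb : ∃ C, ∀ b, |h b| ≤ C) :
    ∫ a, h a.1 * ((a.2 - η a.1) ^ 2 - v a.1) ∂ν = 0

theorem integral_mul_sub_condExp {Ω : Type*} [MeasurableSpace Ω] {P : Measure Ω}
    [IsFiniteMeasure P] {X : Ω → β} (hX : Measurable X) {f : Ω → ℝ} (hf : Integrable f P)
    {h : β → ℝ} (hm : Measurable h) (hb : ∃ C, ∀ b, |h b| ≤ C) :
    ∫ ω, h (X ω) * (f ω - condExp (MeasurableSpace.comap X inferInstance) P f ω) ∂P = 0 := by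
  obtain ⟨C, hC⟩ := hb
  have integrable_mul {u : Ω → ℝ} (hu : Integrable u P) : Integrable (fun ω => h (X ω) * u ω) P :=
    hu.bdd_mul (hm.comp hX).aestronglyMeasurable (.of_forall fun ω => hC (X ω))
  have pull_out := condExp_mul_of_stronglyMeasurable_left
    (hm.comp (comap_measurable X)).stronglyMeasurable (integrable_mul hf) hf
  simp only [mul_sub]
  rw [integral_sub (integrable_mul hf) (integrable_mul integrable_condExp), sub_eq_zero,
    ← integral_condExp hX.comap_le]
  exact integral_congr_ae pull_out

theorem isRegressionModel_map {Ω : Type*} [MeasurableSpace Ω] {P : Measure Ω}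
    [IsFiniteMeasure P] {X : Ω → β} {Y : Ω → ℝ} (hX : Measurable X) (hY : Measurable Y)
    {M : ℝ≥0} (hM : ∀ᵐ ω ∂P, |Y ω| ≤ M) {η v : β → ℝ} (hηm : Measurable η) (hvm : Measurable v)
    (hη : (fun ω => η (X ω)) =ᵐ[P] condExp (MeasurableSpace.comap X inferInstance) P Y)
    (hv : (fun ω => v (X ω)) =ᵐ[P] condVar (MeasurableSpace.comap X inferInstance) Y P) :
    IsRegressionModel (P.map fun ω => (X ω, Y ω)) η v := by
  have hXY : AEMeasurable (fun ω => (X ω, Y ω)) P := (hX.prodMk hY).aemeasurable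
  have variance_eq : (fun ω => v (X ω)) =ᵐ[P] condExp (MeasurableSpace.comap X inferInstance) P
      fun ω => (Y ω - η (X ω)) ^ 2 :=
    hv.trans (condExp_congr_ae (hη.mono fun ω h => by simp [h]))
  have mean_le : ∀ᵐ ω ∂P, |η (X ω)| ≤ M := by
    filter_upwards [hη, ae_bdd_abs_condExp_of_ae_bdd_abs hM] with ω h h'
    rwa [h]
  have noise_le : ∀ᵐ ω ∂P, |Y ω - η (X ω)| ≤ 2 * M := by
    filter_upwards [hM, mean_le] with ω h h'
    exact (abs_sub _ _).trans (by linarith)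
  have noise_sq_le : ∀ᵐ ω ∂P, |(Y ω - η (X ω)) ^ 2| ≤ 4 * M ^ 2 :=
    noise_le.mono fun ω h => by
      rw [abs_pow]
      exact (pow_le_pow_left₀ (abs_nonneg _) h 2).trans_eq (by ring)
  have variance_le : ∀ᵐ ω ∂P, |v (X ω)| ≤ 4 * M ^ 2 := by
    filter_upwards [variance_eq, ae_bdd_abs_condExp_of_ae_bdd_abs noise_sq_le] with ω h h'
    rwa [h]
  refine ⟨hηm, hvm, ⟨2 * M + 4 * M ^ 2, ?_⟩, fun h hm hb => ?_, fun h hm hb => ?_⟩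
  · have le (f : β × ℝ → ℝ) (hf : Measurable f) :
        MeasurableSet {a | |f a| ≤ (2 * M + 4 * M ^ 2 : ℝ≥0)} :=
      measurableSet_le hf.abs measurable_const
    refine (ae_map_iff hXY ((le (fun a => η a.1) (by fun_prop)).inter
      ((le (fun a => a.2 - η a.1) (by fun_prop)).inter
      (le (fun a => v a.1) (by fun_prop))))).2 ?_
    filter_upwards [mean_le, noise_le, variance_le] with ω h₁ h₂ h₃
    have bound_eq : ((2 * M + 4 * M ^ 2 : ℝ≥0) : ℝ) = 2 * M + 4 * M ^ 2 := by push_cast; rfl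
    exact ⟨h₁.trans (by nlinarith [M.2]), h₂.trans (by nlinarith), h₃.trans (by linarith [M.2])⟩
  · rw [integral_map hXY (by fun_prop), ← integral_mul_sub_condExp hX
      (.of_bound hY.aestronglyMeasurable M hM) hm hb]
    exact integral_congr_ae (hη.mono fun ω h => by simp only [← h])
  · rw [integral_map hXY (by fun_prop), ← integral_mul_sub_condExp hX
      (.of_bound (by fun_prop) _ noise_sq_le) hm hb]
    exact integral_congr_ae (variance_eq.mono fun ω h => by simp only [← h])

end RegressionModel

section Noise

variable {ι β : Type*}

theorem fst_update [DecidableEq ι] (p : ι → β × ℝ) (i : ι) (a : β × ℝ) :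
    (fun k => (Function.update p i a k).1) = Function.update (fun k => (p k).1) i a.1 :=
  funext fun k => Function.apply_update (fun _ => Prod.fst) p i a k

variable [Fintype ι]

theorem integral_pi_eq_zero_of_update {α : Type*} [DecidableEq ι] [MeasurableSpace α]
    {μ : Measure α} [IsProbabilityMeasure μ] {f : (ι → α) → ℝ}
    (hf : Integrable f (Measure.pi fun _ => μ)) (i : ι)
    (h : ∀ p, ∫ a, f (Function.update p i a) ∂μ = 0) : ∫ p, f p ∂Measure.pi (fun _ => μ) = 0 := by
  have hi := measurePreserving_update μ i
  have integrable_update := (hi.integrable_comp hf.aestronglyMeasurable).2 hf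
  rw [← hi.map_eq, integral_map hi.aemeasurable (by rw [hi.map_eq]; exact hf.1)]
  exact (integral_prod _ integrable_update).trans (by simp [h])

variable [MeasurableSpace β] {ν : Measure (β × ℝ)} [IsProbabilityMeasure ν] {η v : β → ℝ}
  {g : (ι → β) → ℝ}

theorem IsRegressionModel.integrable_mul_noise_mul_noise (hν : IsRegressionModel ν η v)
    (hg : Measurable g) (hb : ∃ C, ∀ x, |g x| ≤ C) (i j : ι) :
    Integrable (fun p : ι → β × ℝ =>
      g (fun k => (p k).1) * (((p i).2 - η (p i).1) * ((p j).2 - η (p j).1)))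
      (Measure.pi fun _ => ν) := by
  have := hν.measurable_mean
  obtain ⟨C, hC⟩ := hb
  obtain ⟨M, hM⟩ := hν.exists_bound
  have noise_le (i : ι) : ∀ᵐ p ∂Measure.pi (fun _ : ι => ν), |(p i).2 - η (p i).1| ≤ M :=
    (measurePreserving_eval (fun _ : ι => ν) i).quasiMeasurePreserving.ae (hM.mono fun a h => h.2.1)
  refine Integrable.bdd_mul (c := C) (.of_bound (by fun_prop) (M * M) ?_)
    (hg.comp (by fun_prop)).aestronglyMeasurable (.of_forall fun p => hC _)
  filter_upwards [noise_le i, noise_le j] with p hi hj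
  rw [Real.norm_eq_abs, abs_mul]
  exact mul_le_mul hi hj (abs_nonneg _) M.2

theorem IsRegressionModel.integrable_mul_variance (hν : IsRegressionModel ν η v)
    (hg : Measurable g) (hb : ∃ C, ∀ x, |g x| ≤ C) (i : ι) :
    Integrable (fun p : ι → β × ℝ => g (fun k => (p k).1) * v (p i).1)
      (Measure.pi fun _ => ν) := by
  have := hν.measurable_variance
  obtain ⟨C, hC⟩ := hb
  obtain ⟨M, hM⟩ := hν.exists_bound
  refine Integrable.bdd_mul (c := C)
    (.of_bound (this.comp (by fun_prop)).aestronglyMeasurable M ?_)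
    (hg.comp (by fun_prop)).aestronglyMeasurable (.of_forall fun p => hC _)
  exact (measurePreserving_eval (fun _ : ι => ν) i).quasiMeasurePreserving.ae
    (hM.mono fun a h => h.2.2)

theorem IsRegressionModel.integral_mul_noise_mul_noise (hν : IsRegressionModel ν η v)
    (hg : Measurable g) (hb : ∃ C, ∀ x, |g x| ≤ C) {i j : ι} (hij : i ≠ j) :
    ∫ p : ι → β × ℝ, g (fun k => (p k).1) * (((p i).2 - η (p i).1) * ((p j).2 - η (p j).1))
      ∂Measure.pi (fun _ => ν) = 0 := by
  classical
  refine integral_pi_eq_zero_of_update (hν.integrable_mul_noise_mul_noise hg hb i j) i fun p => ?_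
  simp only [fst_update, Function.update_self, Function.update_of_ne hij.symm]
  simp only [← mul_assoc, integral_mul_const]
  obtain ⟨C, hC⟩ := hb
  rw [hν.integral_mul_noise (fun b => g (Function.update (fun k => (p k).1) i b))
    (hg.comp (measurable_update _)) ⟨C, fun b => hC _⟩, zero_mul]

theorem IsRegressionModel.integral_mul_noise_sq_eq (hν : IsRegressionModel ν η v)
    (hg : Measurable g) (hb : ∃ C, ∀ x, |g x| ≤ C) (i : ι) :
    ∫ p : ι → β × ℝ, g (fun k => (p k).1) * (((p i).2 - η (p i).1) * ((p i).2 - η (p i).1))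
      ∂Measure.pi (fun _ => ν) =
      ∫ p : ι → β × ℝ, g (fun k => (p k).1) * v (p i).1 ∂Measure.pi (fun _ => ν) := by
  classical
  have hnoise := hν.integrable_mul_noise_mul_noise hg hb i i
  have hvariance := hν.integrable_mul_variance hg hb i
  rw [← sub_eq_zero, ← integral_sub hnoise hvariance]
  refine integral_pi_eq_zero_of_update (hnoise.sub hvariance) i fun p => ?_
  obtain ⟨C, hC⟩ := hb
  simp only [fst_update, Function.update_self, ← mul_sub, ← sq]
  exact hν.integral_mul_noise_sq (fun b => g (Function.update (fun k => (p k).1) i b))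
    (hg.comp (measurable_update _)) ⟨C, fun b => hC _⟩

theorem IsRegressionModel.integral_sq_sum_mul_noise (hν : IsRegressionModel ν η v)
    {W : (ι → β) → ι → ℝ} (hW : Measurable W) (hb : ∃ C, ∀ x i, |W x i| ≤ C) :
    ∫ p, (∑ i, W (fun k => (p k).1) i * ((p i).2 - η (p i).1)) ^ 2 ∂Measure.pi (fun _ => ν) =
      ∑ i, ∫ p, W (fun k => (p k).1) i ^ 2 * v (p i).1 ∂Measure.pi (fun _ => ν) := by
  obtain ⟨C, hC⟩ := hb
  have hWm (i j : ι) : Measurable fun x => W x i * W x j := by fun_prop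
  have hWb (i j : ι) : ∃ C, ∀ x, |W x i * W x j| ≤ C := ⟨C * C, fun x => by
    rw [abs_mul]
    exact mul_le_mul (hC x i) (hC x j) (abs_nonneg _) ((abs_nonneg _).trans (hC x i))⟩
  have integrable (i j : ι) := hν.integrable_mul_noise_mul_noise (hWm i j) (hWb i j) i j
  have expand (p : ι → β × ℝ) : (∑ i, W (fun k => (p k).1) i * ((p i).2 - η (p i).1)) ^ 2 =
      ∑ i, ∑ j, W (fun k => (p k).1) i * W (fun k => (p k).1) j *
        (((p i).2 - η (p i).1) * ((p j).2 - η (p j).1)) := by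
    simp only [sq, Finset.sum_mul_sum]
    exact Finset.sum_congr rfl fun i _ => Finset.sum_congr rfl fun j _ => mul_mul_mul_comm ..
  simp only [expand, sq (W _ _)]
  rw [integral_finsetSum _ fun i _ => integrable_finsetSum _ fun j _ => integrable i j]
  refine Finset.sum_congr rfl fun i _ => ?_
  rw [integral_finsetSum _ fun j _ => integrable i j,
    ← hν.integral_mul_noise_sq_eq (hWm i i) (hWb i i)]
  exact Finset.sum_eq_single i
    (fun j _ hji => hν.integral_mul_noise_mul_noise (hWm i j) (hWb i j) hji.symm) (by simp)

end Noise

section SampleLaw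

variable {E : Type*} [MeasurableSpace E]

/-- The distribution of an iid sample of labeled points with distribution `ν`, paired with the
unlabeled point of an independent test example. -/
noncomputable abbrev sampleLaw (ι : Type*) [Fintype ι] (ν : Measure (E × ℝ)) :
    Measure ((ι → E × ℝ) × E) :=
  (Measure.pi fun _ => ν).prod ν.fst

variable {ι : Type*} [Fintype ι] {ν : Measure (E × ℝ)} [IsProbabilityMeasure ν]

theorem ae_pi_points {s : Set (ι → E)} (hs : ∀ᵐ x ∂Measure.pi fun _ : ι => ν.fst, x ∈ s) :
    ∀ᵐ p ∂Measure.pi fun _ : ι => ν, (fun k => (p k).1) ∈ s :=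
  (measurePreserving_pi (fun _ : ι => ν) (fun _ => ν.fst) fun _ =>
    measurable_fst.measurePreserving ν).quasiMeasurePreserving.ae hs

theorem ae_pi_forall {α : Type*} [MeasurableSpace α] {ν : Measure α} [IsProbabilityMeasure ν]
    {s : Set α} (hs : ∀ᵐ a ∂ν, a ∈ s) : ∀ᵐ p ∂Measure.pi fun _ : ι => ν, ∀ i, p i ∈ s :=
  ae_all_iff.2 fun i =>
    (measurePreserving_eval (fun _ : ι => ν) i).quasiMeasurePreserving.ae hs

end SampleLaw

section NoiseVariance

variable {ι E : Type*} [Fintype ι] [NormedAddCommGroup E] [InnerProductSpace ℝ E]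

theorem abs_sum_delaunayWeight_mul_le {x : ι → E} {z : E} {y : ι → ℝ} {M : ℝ≥0}
    (hy : ∀ i, |y i| ≤ M) : |∑ i, delaunayWeight x z i * y i| ≤ M :=
  calc |∑ i, delaunayWeight x z i * y i|
      ≤ ∑ i, |delaunayWeight x z i * y i| := Finset.abs_sum_le_sum_abs _ _
    _ ≤ ∑ i, delaunayWeight x z i * M := Finset.sum_le_sum fun i _ => by
      rw [abs_mul, abs_of_nonneg (delaunayWeight_nonneg i)]
      exact mul_le_mul_of_nonneg_left (hy i) (delaunayWeight_nonneg i)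
    _ = (∑ i, delaunayWeight x z i) * M := by rw [Finset.sum_mul]
    _ ≤ M := mul_le_of_le_one_left M.2 sum_delaunayWeight_le_one

/-- The noise `y - η x` of the labels of the sample `p`, interpolated at `z`. -/
noncomputable def interpolatedNoise (η : E → ℝ) (p : ι → E × ℝ) (z : E) : ℝ :=
  ∑ i, delaunayWeight (fun k => (p k).1) z i * ((p i).2 - η (p i).1)

variable [MeasurableSpace E]

theorem IsRegressionModel.exists_ae_abs_interpolatedNoise_le {ν : Measure (E × ℝ)}
    [IsProbabilityMeasure ν] {η v : E → ℝ} (hν : IsRegressionModel ν η v) :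
    ∃ M : ℝ≥0, ∀ (ι : Type*) [Fintype ι], ∀ᵐ q ∂sampleLaw ι ν,
      |interpolatedNoise η q.1 q.2| ≤ M := by
  obtain ⟨M, hM⟩ := hν.exists_bound
  refine ⟨M, fun ι _ => ?_⟩
  filter_upwards [measurePreserving_fst.quasiMeasurePreserving.ae
    (ae_pi_forall (ι := ι) (hM.mono fun a h => h.2.1))] with q hq
  exact abs_sum_delaunayWeight_mul_le hq

variable [FiniteDimensional ℝ E] [BorelSpace E]

theorem GeneralPosition.integral_sq_delaunayWeight_cond {ρ : Measure E} [ρ.IsAddHaarMeasure]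
    {K : Set E} {x : ι → E} (hx : GeneralPosition x) (hK : Convex ℝ K) (hxK : ∀ i, x i ∈ K)
    (i : ι) : ∫ z, delaunayWeight x z i ^ 2 ∂ρ[|K] =
      2 / (finrank ℝ E + 2) * ∫ z, delaunayWeight x z i ∂ρ[|K] := by
  have hm : Measurable fun z => delaunayWeight x z i :=
    (measurable_pi_apply i).comp (measurable_delaunayWeight.comp measurable_prodMk_left)
  have eq_zero_of_notMem (z : E) (hz : z ∉ K) : delaunayWeight x z i = 0 := by
    by_contra h
    exact hz (convexHull_min (range_subset_iff.2 hxK) hK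
      (isDelaunayWeight_of_delaunayWeight_ne_zero h).mem_convexHull)
  rw [ProbabilityTheory.cond, integral_smul_measure, integral_smul_measure,
    setIntegral_eq_integral_of_forall_compl_eq_zero fun z hz => by simp [eq_zero_of_notMem z hz],
    setIntegral_eq_integral_of_forall_compl_eq_zero eq_zero_of_notMem,
    integral_eq_lintegral_of_nonneg_ae (.of_forall fun z => sq_nonneg _)
      (hm.pow_const 2).aestronglyMeasurable,
    integral_eq_lintegral_of_nonneg_ae (.of_forall fun z => delaunayWeight_nonneg i)
      hm.aestronglyMeasurable, hx.lintegral_sq_delaunayWeight ρ i hm.aemeasurable,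
    ENNReal.toReal_mul, ENNReal.toReal_ofReal (by positivity), mul_smul_comm]

theorem measurable_delaunayWeight_points (i : ι) :
    Measurable fun q : (ι → E × ℝ) × E => delaunayWeight (fun k => (q.1 k).1) q.2 i :=
  (measurable_pi_apply i).comp (measurable_delaunayWeight.comp
    (f := fun q : (ι → E × ℝ) × E => ((fun k => (q.1 k).1), q.2)) (by fun_prop))

variable {ν : Measure (E × ℝ)} [IsProbabilityMeasure ν] {η v : E → ℝ}

theorem measurable_interpolatedNoise (hη : Measurable η) :
    Measurable fun q : (ι → E × ℝ) × E => interpolatedNoise η q.1 q.2 :=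
  Finset.measurable_fun_sum _ fun i _ => (measurable_delaunayWeight_points i).mul (by fun_prop)

theorem IsRegressionModel.integrable_delaunayWeight_pow_mul (hν : IsRegressionModel ν η v) (i : ι)
    (e : ℕ) : Integrable (fun q : (ι → E × ℝ) × E =>
      delaunayWeight (fun k => (q.1 k).1) q.2 i ^ e * v (q.1 i).1) (sampleLaw ι ν) := by
  have := hν.measurable_variance
  obtain ⟨M, hM⟩ := hν.exists_bound
  refine Integrable.bdd_mul (c := 1)
    (.of_bound (this.comp (by fun_prop)).aestronglyMeasurable M ?_)
    ((measurable_delaunayWeight_points i).pow_const e).aestronglyMeasurable (.of_forall fun q => ?_)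
  · exact measurePreserving_fst.quasiMeasurePreserving.ae ((measurePreserving_eval (fun _ : ι => ν)
      i).quasiMeasurePreserving.ae (hM.mono fun a h => h.2.2))
  · rw [norm_pow, Real.norm_of_nonneg (delaunayWeight_nonneg i)]
    exact pow_le_one₀ (delaunayWeight_nonneg i) (delaunayWeight_le_one i)

theorem IsRegressionModel.integral_sq_interpolatedNoise_eq_sum (hν : IsRegressionModel ν η v) :
    ∫ q, interpolatedNoise η q.1 q.2 ^ 2 ∂sampleLaw ι ν =
      ∑ i, ∫ q, delaunayWeight (fun k => (q.1 k).1) q.2 i ^ 2 * v (q.1 i).1 ∂sampleLaw ι ν := by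
  have integrable_sq : Integrable (fun q : (ι → E × ℝ) × E => interpolatedNoise η q.1 q.2 ^ 2)
      (sampleLaw ι ν) := by
    obtain ⟨M, hM⟩ := hν.exists_ae_abs_interpolatedNoise_le
    refine .of_bound ((measurable_interpolatedNoise hν.measurable_mean).pow_const
      2).aestronglyMeasurable (M ^ 2) ((hM ι).mono fun q hq => ?_)
    rw [norm_pow]
    exact pow_le_pow_left₀ (abs_nonneg _) hq 2
  have inner_integral (z : E) : ∫ p, interpolatedNoise η p z ^ 2 ∂Measure.pi (fun _ : ι => ν) =
      ∑ i, ∫ p, delaunayWeight (fun k => (p k).1) z i ^ 2 * v (p i).1 ∂Measure.pi (fun _ => ν) :=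
    hν.integral_sq_sum_mul_noise (measurable_delaunayWeight.comp measurable_prodMk_right)
      ⟨1, fun x i => (abs_of_nonneg (delaunayWeight_nonneg i)).trans_le (delaunayWeight_le_one i)⟩
  have integrable := hν.integrable_delaunayWeight_pow_mul (ι := ι) (e := 2)
  rw [integral_prod_symm _ integrable_sq]
  simp only [inner_integral]
  rw [integral_finsetSum _ fun i _ => (integrable i).integral_prod_right]
  exact Finset.sum_congr rfl fun i _ => (integral_prod_symm _ (integrable i)).symm

theorem IsRegressionModel.integral_sq_interpolatedNoise [Nontrivial E] {ρ : Measure E}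
    [ρ.IsAddHaarMeasure] {K : Set E} (hν : IsRegressionModel ν η v) (hρ : ν.fst = ρ[|K])
    (hK : Convex ℝ K) : ∫ q, interpolatedNoise η q.1 q.2 ^ 2 ∂sampleLaw ι ν =
      2 / (finrank ℝ E + 2) * ∫ q, ∑ i, delaunayWeight (fun k => (q.1 k).1) q.2 i * v (q.1 i).1
        ∂sampleLaw ι ν := by
  have integrable := hν.integrable_delaunayWeight_pow_mul (ι := ι)
  have integrable_one (i : ι) := by simpa only [pow_one] using integrable i 1
  have generalPosition : ∀ᵐ p ∂Measure.pi fun _ : ι => ν, GeneralPosition fun k => (p k).1 :=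
    ae_pi_points (ae_generalPosition (μ := ρ) (hρ ▸ cond_absolutelyContinuous))
  have mem_K : ∀ᵐ p ∂Measure.pi fun _ : ι => ν, ∀ i, (p i).1 ∈ K :=
    ae_pi_points (ae_pi_forall (hρ ▸ ae_cond_mem₀ (hK.nullMeasurableSet ρ)))
  rw [hν.integral_sq_interpolatedNoise_eq_sum, integral_finsetSum _ fun i _ => integrable_one i,
    Finset.mul_sum]
  refine Finset.sum_congr rfl fun i _ => ?_
  rw [integral_prod _ (integrable i 2), integral_prod _ (integrable_one i), ← integral_const_mul]
  refine integral_congr_ae ?_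
  filter_upwards [generalPosition, mem_K] with p hp hpK
  rw [integral_mul_const, integral_mul_const, hρ, hp.integral_sq_delaunayWeight_cond hK hpK i,
    mul_assoc]

end NoiseVariance

section Bias

variable {ι E : Type*} [Fintype ι] [NormedAddCommGroup E] [InnerProductSpace ℝ E] {η : E → ℝ}

/-- The error at `z` of the interpolant of the noiseless labels `η (x i)`. -/
noncomputable def interpolationBias (η : E → ℝ) (x : ι → E) (z : E) : ℝ :=
  ∑ i, delaunayWeight x z i * η (x i) + 1 / 2 * (1 - ∑ i, delaunayWeight x z i) - η z

theorem abs_interpolationBias_le {x : ι → E} {z : E} {M : ℝ≥0} (hx : ∀ i, |η (x i)| ≤ M)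
    (hz : |η z| ≤ M) : |interpolationBias η x z| ≤ 2 * M + 1 / 2 := by
  have hsum := abs_le.1 (abs_sum_delaunayWeight_mul_le (x := x) (z := z) hx)
  have hle : ∑ i, delaunayWeight x z i ≤ 1 := sum_delaunayWeight_le_one
  have hnonneg : 0 ≤ ∑ i, delaunayWeight x z i :=
    Finset.sum_nonneg fun i _ => delaunayWeight_nonneg i
  rw [abs_le] at hz
  rw [interpolationBias, abs_le]
  constructor <;> linarith

theorem IsRegressionModel.exists_ae_abs_interpolationBias_le [MeasurableSpace E]
    {ν : Measure (E × ℝ)} [IsProbabilityMeasure ν] {v : E → ℝ} (hν : IsRegressionModel ν η v) :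
    ∃ C : ℝ≥0, ∀ (ι : Type*) [Fintype ι], ∀ᵐ q ∂sampleLaw ι ν,
      |interpolationBias η (fun k => (q.1 k).1) q.2| ≤ C := by
  obtain ⟨M, hM⟩ := hν.exists_bound
  have mean_le : ∀ᵐ z ∂ν.fst, |η z| ≤ M :=
    (ae_map_iff measurable_fst.aemeasurable
      (measurableSet_le hν.measurable_mean.abs measurable_const)).2 (hM.mono fun a h => h.1)
  refine ⟨2 * M + 1 / 2, fun ι _ => ?_⟩
  filter_upwards [measurePreserving_fst.quasiMeasurePreserving.ae
    (ae_pi_forall (ι := ι) (hM.mono fun a h => h.1)),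
    measurePreserving_snd.quasiMeasurePreserving.ae mean_le] with q hq hq'
  exact (abs_interpolationBias_le hq hq').trans_eq (by push_cast; rfl)

theorem measurable_interpolationBias [FiniteDimensional ℝ E] [MeasurableSpace E] [BorelSpace E]
    (hη : Measurable η) :
    Measurable fun q : (ι → E × ℝ) × E => interpolationBias η (fun k => (q.1 k).1) q.2 := by
  have weight (i : ι) := measurable_delaunayWeight_points (E := E) i
  unfold interpolationBias
  fun_prop

theorem IsDelaunayTriangulation.simplicialInterpolant_sub_eq {d n : ℕ}
    {p : Fin n → EuclideanSpace ℝ (Fin d) × ℝ} {T : Set (Finset (Fin n))}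
    (hT : IsDelaunayTriangulation (fun i => (p i).1) T) (hp : GeneralPosition fun i => (p i).1)
    (η : EuclideanSpace ℝ (Fin d) → ℝ) (z : EuclideanSpace ℝ (Fin d)) :
    simplicialInterpolant T (fun i => (p i).1) (fun i => (p i).2) z - η z =
      interpolatedNoise η p z + interpolationBias η (fun i => (p i).1) z := by
  rw [hT.simplicialInterpolant_eq hp, interpolatedNoise, interpolationBias]
  simp only [mul_sub, Finset.sum_sub_distrib]
  ring

end Bias

section Limits

variable {Ω : Type*} [MeasurableSpace Ω] {P : Measure Ω}

theorem tendsto_integral_sq_add [IsFiniteMeasure P] {S B : ℕ → Ω → ℝ}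
    (hS : ∀ n, AEStronglyMeasurable (S n) P) (hB : ∀ n, AEStronglyMeasurable (B n) P) {M C : ℝ≥0}
    (hSM : ∀ n, ∀ᵐ ω ∂P, |S n ω| ≤ M) (hBC : ∀ n, ∀ᵐ ω ∂P, |B n ω| ≤ C)
    (hB0 : ∀ᵐ ω ∂P, Tendsto (fun n => B n ω) atTop (𝓝 0)) {L : ℝ}
    (hL : Tendsto (fun n => ∫ ω, S n ω ^ 2 ∂P) atTop (𝓝 L)) :
    Tendsto (fun n => ∫ ω, (S n ω + B n ω) ^ 2 ∂P) atTop (𝓝 L) := by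
  have integrable_sq (n : ℕ) : Integrable (fun ω => S n ω ^ 2) P :=
    .of_bound ((hS n).pow 2) (M ^ 2) ((hSM n).mono fun ω h => by
      rw [norm_pow]
      exact pow_le_pow_left₀ (abs_nonneg _) h 2)
  have hR (n : ℕ) : AEStronglyMeasurable (fun ω => B n ω * (2 * S n ω + B n ω)) P :=
    (hB n).mul (((hS n).const_mul 2).add (hB n))
  have abs_remainder_le (n : ℕ) :
      ∀ᵐ ω ∂P, ‖B n ω * (2 * S n ω + B n ω)‖ ≤ |B n ω| * (2 * M + C) := by
    filter_upwards [hSM n, hBC n] with ω h h'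
    rw [norm_mul, Real.norm_eq_abs, Real.norm_eq_abs]
    refine mul_le_mul_of_nonneg_left ((abs_add_le _ _).trans (add_le_add ?_ h')) (abs_nonneg _)
    rw [abs_mul, abs_two]
    linarith
  have abs_remainder_le_const (n : ℕ) :
      ∀ᵐ ω ∂P, ‖B n ω * (2 * S n ω + B n ω)‖ ≤ C * (2 * M + C) := by
    filter_upwards [abs_remainder_le n, hBC n] with ω h h'
    exact h.trans (mul_le_mul_of_nonneg_right h' (by positivity))
  have remainder : Tendsto (fun n => ∫ ω, B n ω * (2 * S n ω + B n ω) ∂P) atTop (𝓝 0) := by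
    rw [← integral_zero Ω ℝ (μ := P)]
    refine tendsto_integral_of_dominated_convergence _ hR (integrable_const _)
      abs_remainder_le_const ?_
    filter_upwards [hB0, ae_all_iff.2 abs_remainder_le] with ω h h'
    exact squeeze_zero_norm h' (by simpa using h.abs.mul_const (2 * (M : ℝ) + C))
  have sum := hL.add remainder
  rw [add_zero] at sum
  refine sum.congr fun n => ?_
  rw [← integral_add (integrable_sq n) (.of_bound (hR n) _ (abs_remainder_le_const n))]
  exact integral_congr_ae (.of_forall fun ω => by ring)

theorem measurable_indicator_of_continuousOn {β : Type*} [TopologicalSpace β] [MeasurableSpace β]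
    [BorelSpace β] {s : Set β} {g : β → ℝ} (hg : ContinuousOn g s) (hs : MeasurableSet s) :
    Measurable (s.indicator g) := by
  classical
  rw [← piecewise_eq_indicator]
  exact hg.measurable_piecewise continuousOn_const hs

theorem ae_support_subset_closure_range {β : Type*} [TopologicalSpace β]
    [SecondCountableTopology β] [MeasurableSpace β] [OpensMeasurableSpace β] {μ : Measure β}
    [IsProbabilityMeasure μ] {x : ℕ → Ω → β}
    (hx : ∀ n, MeasurePreserving (fun ω (i : Fin n) => x i ω) P (Measure.pi fun _ => μ)) :
    ∀ᵐ ω ∂P, μ.support ⊆ closure (range fun i => x i ω) := by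
  have visits (V : Set β) (hV : IsOpen V) (hμV : μ V ≠ 0) : ∀ᵐ ω ∂P, ∃ i, x i ω ∈ V := by
    have avoid_le (n : ℕ) : P {ω | ∀ i, x i ω ∉ V} ≤ μ Vᶜ ^ n :=
      calc P {ω | ∀ i, x i ω ∉ V}
          ≤ P ((fun ω (i : Fin n) => x i ω) ⁻¹' univ.pi fun _ => Vᶜ) :=
            measure_mono fun ω hω i _ => hω i
        _ = μ Vᶜ ^ n := by
            rw [(hx n).measure_preimage
              (MeasurableSet.univ_pi fun _ => hV.measurableSet.compl).nullMeasurableSet,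
              Measure.pi_pi, Finset.prod_const, Finset.card_univ, Fintype.card_fin]
    have hlt : μ Vᶜ < 1 := by
      rw [prob_compl_eq_one_sub hV.measurableSet]
      exact ENNReal.sub_lt_self ENNReal.one_ne_top one_ne_zero hμV
    rw [ae_iff]
    push Not
    exact le_antisymm (ge_of_tendsto' (ENNReal.tendsto_pow_atTop_nhds_zero_of_lt_one hlt) avoid_le)
      zero_le
  have visits_basis : ∀ᵐ ω ∂P, ∀ V ∈ TopologicalSpace.countableBasis β,
      μ V ≠ 0 → ∃ i, x i ω ∈ V :=
    (ae_ball_iff (TopologicalSpace.countable_countableBasis β)).2 fun V hV =>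
      eventually_imp_distrib_left.2 fun hμV =>
        visits V (TopologicalSpace.isOpen_of_mem_countableBasis hV) hμV
  filter_upwards [visits_basis] with ω hω z hz
  rw [(TopologicalSpace.isBasis_countableBasis β).mem_closure_iff]
  intro V hV hzV
  have hμV := (Measure.mem_support_iff_forall z).1 hz V
    ((TopologicalSpace.isOpen_of_mem_countableBasis hV).mem_nhds hzV)
  obtain ⟨i, hi⟩ := hω V hV hμV.ne'
  exact ⟨x i ω, hi, i, rfl⟩

theorem interior_subset_support_cond {β : Type*} [TopologicalSpace β] [MeasurableSpace β]
    {ρ : Measure β} [ρ.IsOpenPosMeasure] {K : Set β} (hK : ρ[|K] ≠ 0) :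
    interior K ⊆ (ρ[|K]).support := by
  intro z hz
  refine (Measure.mem_support_iff_forall z).2 fun V hV => ?_
  have hopen : IsOpen (interior V ∩ interior K) := isOpen_interior.inter isOpen_interior
  have hpos : 0 < ρ (interior V ∩ interior K) :=
    hopen.measure_pos ρ ⟨z, mem_interior_iff_mem_nhds.2 hV, hz⟩
  refine lt_of_lt_of_le ?_ (measure_mono (inter_subset_left.trans interior_subset :
    interior V ∩ interior K ⊆ V))
  rw [ProbabilityTheory.cond, Measure.smul_apply, Measure.restrict_eq_self _
    (inter_subset_right.trans interior_subset), smul_eq_mul]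
  exact ENNReal.mul_pos (ENNReal.inv_ne_zero.2 fun h => hK (cond_eq_zero.2 (.inl h))) hpos.ne'

theorem ae_cond_mem_interior {E : Type*} [NormedAddCommGroup E] [NormedSpace ℝ E]
    [FiniteDimensional ℝ E] [MeasurableSpace E] [BorelSpace E] {ρ : Measure E} [ρ.IsAddHaarMeasure]
    {K : Set E} (hK : Convex ℝ K) : ∀ᵐ z ∂ρ[|K], z ∈ interior K := by
  filter_upwards [ae_cond_mem₀ (hK.nullMeasurableSet ρ), cond_absolutelyContinuous.ae_le
    (interior_ae_eq_of_null_frontier (hK.addHaar_frontier ρ))] with z hz hint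
  exact (iff_of_eq hint).2 hz

end Limits

section Asymptotics

variable {E Ω : Type*} [MeasurableSpace E] [MeasurableSpace Ω] {P : Measure Ω}

/-- The first `n` training examples, paired with the unlabeled test point. -/
abbrev sample (Z : ℕ → Ω → E × ℝ) (U : Ω → E) (n : ℕ) (ω : Ω) : (Fin n → E × ℝ) × E :=
  (fun i => Z i ω, U ω)

theorem measurePreserving_sample [IsProbabilityMeasure P] {Z : ℕ → Ω → E × ℝ} {Z₀ : Ω → E × ℝ}
    (hZ : ∀ i, Measurable (Z i)) (hZ₀ : Measurable Z₀)
    (h_ident : ∀ i, IdentDistrib (Z i) Z₀ P P) (h_indep : iIndepFun Z P)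
    (h_test : IndepFun (fun ω i => Z i ω) Z₀ P) (n : ℕ) :
    MeasurePreserving (sample Z (fun ω => (Z₀ ω).1) n) P (sampleLaw (Fin n) (P.map Z₀)) := by
  have test : IndepFun (fun ω (i : Fin n) => Z i ω) (fun ω => (Z₀ ω).1) P :=
    h_test.comp (φ := fun (p : ℕ → E × ℝ) (i : Fin n) => p i) (ψ := Prod.fst) (by fun_prop)
      measurable_fst
  have train : iIndepFun (fun i : Fin n => Z i) P := h_indep.precomp Fin.val_injective
  refine ⟨by fun_prop, ?_⟩
  rw [(indepFun_iff_map_prod_eq_prod_map_map (f := fun ω (i : Fin n) => Z i ω) (by fun_prop)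
    (by fun_prop)).1 test, (iIndepFun_iff_map_fun_eq_pi_map (f := fun i : Fin n => Z i) fun i =>
    (hZ i).aemeasurable).1 train, sampleLaw, Measure.fst, Measure.map_map measurable_fst hZ₀]
  simp only [(h_ident _).map_eq]
  rfl

variable {ν : Measure (E × ℝ)} [IsProbabilityMeasure ν] {Z : ℕ → Ω → E × ℝ} {U : Ω → E}

theorem measurePreserving_test
    (hZ : ∀ n, MeasurePreserving (sample Z U n) P (sampleLaw (Fin n) ν)) :
    MeasurePreserving U P ν.fst :=
  measurePreserving_snd.comp (hZ 0)

theorem measurePreserving_train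
    (hZ : ∀ n, MeasurePreserving (sample Z U n) P (sampleLaw (Fin n) ν)) (n : ℕ) :
    MeasurePreserving (fun ω (i : Fin n) => Z i ω) P (Measure.pi fun _ => ν) :=
  measurePreserving_fst.comp (hZ n)

theorem IsRegressionModel.integral_noise_sq {η v : E → ℝ} (hν : IsRegressionModel ν η v) :
    ∫ a, (a.2 - η a.1) ^ 2 ∂ν = ∫ z, v z ∂ν.fst := by
  have hηm := hν.measurable_mean
  obtain ⟨M, hM⟩ := hν.exists_bound
  have integrable_noise_sq : Integrable (fun a => (a.2 - η a.1) ^ 2) ν :=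
    .of_bound (by fun_prop) (M ^ 2) (hM.mono fun a h => by
      rw [norm_pow]
      exact pow_le_pow_left₀ (abs_nonneg _) h.2.1 2)
  have integrable_variance : Integrable (fun a => v a.1) ν :=
    .of_bound (hν.measurable_variance.comp measurable_fst).aestronglyMeasurable M
      (hM.mono fun a h => h.2.2)
  have := hν.integral_mul_noise_sq 1 measurable_const ⟨1, by simp⟩
  simp only [Pi.one_apply, one_mul] at this
  rw [integral_sub integrable_noise_sq integrable_variance, sub_eq_zero] at this
  rw [this, Measure.fst, integral_map measurable_fst.aemeasurable
    hν.measurable_variance.aestronglyMeasurable]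

variable [NormedAddCommGroup E] [InnerProductSpace ℝ E] [FiniteDimensional ℝ E] [BorelSpace E]
  {η v : E → ℝ}

theorem IsRegressionModel.integrable_sq_error [IsFiniteMeasure P]
    (hν : IsRegressionModel ν η v) {n : ℕ}
    (hZ : MeasurePreserving (sample Z U n) P (sampleLaw (Fin n) ν)) :
    Integrable (fun ω => (interpolatedNoise η (fun i : Fin n => Z i ω) (U ω) +
      interpolationBias η (fun i : Fin n => (Z i ω).1) (U ω)) ^ 2) P := by
  obtain ⟨M, hM⟩ := hν.exists_ae_abs_interpolatedNoise_le
  obtain ⟨C, hC⟩ := hν.exists_ae_abs_interpolationBias_le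
  have hmeas := (measurable_interpolatedNoise (ι := Fin n) hν.measurable_mean).add
    (measurable_interpolationBias hν.measurable_mean)
  refine .of_bound ((hmeas.pow_const 2).comp_aemeasurable hZ.aemeasurable).aestronglyMeasurable
    ((M + C) ^ 2) ?_
  filter_upwards [hZ.quasiMeasurePreserving.ae (hM (Fin n)),
    hZ.quasiMeasurePreserving.ae (hC (Fin n))] with ω h h'
  rw [norm_pow]
  exact pow_le_pow_left₀ (norm_nonneg _) ((norm_add_le _ _).trans (add_le_add h h')) 2

variable [Nontrivial E] {ρ : Measure E} [ρ.IsAddHaarMeasure] {K : Set E}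

theorem ae_generalPosition_sample
    (hZ : ∀ n, MeasurePreserving (sample Z U n) P (sampleLaw (Fin n) ν)) (hρ : ν.fst = ρ[|K]) :
    ∀ᵐ ω ∂P, ∀ n, GeneralPosition fun k : Fin n => (Z k ω).1 :=
  ae_all_iff.2 fun n => (measurePreserving_train hZ n).quasiMeasurePreserving.ae
    (ae_pi_points (ae_generalPosition (μ := ρ) (hρ ▸ cond_absolutelyContinuous)))

theorem ae_tendsto_sum_delaunayWeight
    (hZ : ∀ n, MeasurePreserving (sample Z U n) P (sampleLaw (Fin n) ν))
    (hρ : ν.fst = ρ[|K]) (hK : Convex ℝ K)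
    (hE : ∀ᶠ n in atTop, ∀ x : Fin n → E, GeneralPosition x →
      ∀ z ∈ convexHull ℝ (range x), ∃ w, IsDelaunayWeight x z w) :
    ∀ᵐ ω ∂P, ∀ g : E → ℝ, ContinuousOn g (interior K) →
      Tendsto (fun n => ∑ i : Fin n, delaunayWeight (fun k : Fin n => (Z k ω).1) (U ω) i *
        g (Z i ω).1) atTop (𝓝 (g (U ω))) := by
  have mem_interior : ∀ᵐ ω ∂P, U ω ∈ interior K :=
    (measurePreserving_test hZ).quasiMeasurePreserving.ae (hρ ▸ ae_cond_mem_interior hK)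
  have cond_isProbabilityMeasure : IsProbabilityMeasure ρ[|K] := hρ ▸ inferInstance
  have dense : ∀ᵐ ω ∂P, (ρ[|K]).support ⊆ closure (range fun i => (Z i ω).1) :=
    ae_support_subset_closure_range fun n => hρ ▸ (measurePreserving_pi _ _ fun _ =>
      measurable_fst.measurePreserving ν).comp (measurePreserving_train hZ n)
  filter_upwards [ae_generalPosition_sample hZ hρ, mem_interior, dense] with ω hgp hU hdense g hg
  have hUK : interior K ∈ 𝓝 (U ω) := isOpen_interior.mem_nhds hU
  refine tendsto_sum_delaunayWeight (p := fun i => (Z i ω).1)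
    (mem_of_superset hUK ((interior_subset_support_cond (NeZero.ne _)).trans hdense))
    (hE.mono fun n hn hz => ?_) (hg.continuousAt hUK)
  obtain ⟨w, hw⟩ := hn _ (hgp n) _ hz
  rwa [(hgp n).delaunayWeight_eq hw]

theorem IsRegressionModel.tendsto_integral_sq_interpolatedNoise [IsFiniteMeasure P]
    (hν : IsRegressionModel ν η v)
    (hZ : ∀ n, MeasurePreserving (sample Z U n) P (sampleLaw (Fin n) ν))
    (hρ : ν.fst = ρ[|K]) (hK : Convex ℝ K) (hv : ContinuousOn v (interior K))
    (hE : ∀ᶠ n in atTop, ∀ x : Fin n → E, GeneralPosition x →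
      ∀ z ∈ convexHull ℝ (range x), ∃ w, IsDelaunayWeight x z w) :
    Tendsto (fun n => ∫ ω, interpolatedNoise η (fun i : Fin n => Z i ω) (U ω) ^ 2 ∂P) atTop
      (𝓝 (2 / (finrank ℝ E + 2) * ∫ a, (a.2 - η a.1) ^ 2 ∂ν)) := by
  have hvm := hν.measurable_variance
  have hηm := hν.measurable_mean
  obtain ⟨M, hM⟩ := hν.exists_bound
  have hsum (n : ℕ) : Measurable fun q : (Fin n → E × ℝ) × E =>
      ∑ i, delaunayWeight (fun k => (q.1 k).1) q.2 i * v (q.1 i).1 :=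
    Finset.measurable_fun_sum _ fun i _ =>
      (measurable_delaunayWeight_points i).mul (hvm.comp (by fun_prop))
  have variance_eq (n : ℕ) : ∫ ω, interpolatedNoise η (fun i : Fin n => Z i ω) (U ω) ^ 2 ∂P =
      2 / (finrank ℝ E + 2) * ∫ ω, ∑ i : Fin n,
        delaunayWeight (fun k : Fin n => (Z k ω).1) (U ω) i * v (Z i ω).1 ∂P := by
    have := hν.integral_sq_interpolatedNoise (ι := Fin n) hρ hK
    rw [← (hZ n).map_eq, integral_map (hZ n).aemeasurable
      ((measurable_interpolatedNoise hηm).pow_const 2).aestronglyMeasurable,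
      integral_map (hZ n).aemeasurable (hsum n).aestronglyMeasurable] at this
    exact this
  have limit_eq : ∫ ω, v (U ω) ∂P = ∫ a, (a.2 - η a.1) ^ 2 ∂ν := by
    have hU := measurePreserving_test hZ
    rw [hν.integral_noise_sq, ← hU.map_eq, integral_map hU.aemeasurable hvm.aestronglyMeasurable]
  simp only [variance_eq, ← limit_eq]
  refine (tendsto_integral_of_dominated_convergence (fun _ => (M : ℝ))
    (fun n => ?_) (integrable_const _) (fun n => ?_) ?_).const_mul _
  · exact ((hsum n).comp_aemeasurable (hZ n).aemeasurable).aestronglyMeasurable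
  · filter_upwards [(measurePreserving_train hZ n).quasiMeasurePreserving.ae
      (ae_pi_forall (ι := Fin n) (hM.mono fun a h => h.2.2))] with ω hω
    exact abs_sum_delaunayWeight_mul_le hω
  · filter_upwards [ae_tendsto_sum_delaunayWeight hZ hρ hK hE] with ω hω using hω v hv

theorem ae_tendsto_interpolationBias
    (hZ : ∀ n, MeasurePreserving (sample Z U n) P (sampleLaw (Fin n) ν))
    (hρ : ν.fst = ρ[|K]) (hK : Convex ℝ K) (hη : ContinuousOn η (interior K))
    (hE : ∀ᶠ n in atTop, ∀ x : Fin n → E, GeneralPosition x →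
      ∀ z ∈ convexHull ℝ (range x), ∃ w, IsDelaunayWeight x z w) :
    ∀ᵐ ω ∂P, Tendsto (fun n => interpolationBias η (fun i : Fin n => (Z i ω).1) (U ω)) atTop
      (𝓝 0) := by
  filter_upwards [ae_tendsto_sum_delaunayWeight hZ hρ hK hE] with ω hω
  have total := hω (fun _ => 1) continuousOn_const
  simp only [mul_one] at total
  simpa only [interpolationBias, sub_self, mul_zero, add_zero] using
    ((hω η hη).add ((total.const_sub 1).const_mul (1 / 2))).sub_const (η (U ω))

theorem IsRegressionModel.tendsto_integral_sq_error [IsFiniteMeasure P]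
    (hν : IsRegressionModel ν η v)
    (hZ : ∀ n, MeasurePreserving (sample Z U n) P (sampleLaw (Fin n) ν))
    (hρ : ν.fst = ρ[|K]) (hK : Convex ℝ K) (hη : ContinuousOn η (interior K))
    (hv : ContinuousOn v (interior K))
    (hE : ∀ᶠ n in atTop, ∀ x : Fin n → E, GeneralPosition x →
      ∀ z ∈ convexHull ℝ (range x), ∃ w, IsDelaunayWeight x z w) :
    Tendsto (fun n => ∫ ω, (interpolatedNoise η (fun i : Fin n => Z i ω) (U ω) +
      interpolationBias η (fun i : Fin n => (Z i ω).1) (U ω)) ^ 2 ∂P) atTop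
      (𝓝 (2 / (finrank ℝ E + 2) * ∫ a, (a.2 - η a.1) ^ 2 ∂ν)) := by
  obtain ⟨M, hM⟩ := hν.exists_ae_abs_interpolatedNoise_le
  obtain ⟨C, hC⟩ := hν.exists_ae_abs_interpolationBias_le
  exact tendsto_integral_sq_add
    (fun n => ((measurable_interpolatedNoise hν.measurable_mean).comp_aemeasurable
      (hZ n).aemeasurable).aestronglyMeasurable)
    (fun n => ((measurable_interpolationBias hν.measurable_mean).comp_aemeasurable
      (hZ n).aemeasurable).aestronglyMeasurable)
    (fun n => (hZ n).quasiMeasurePreserving.ae (hM (Fin n)))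
    (fun n => (hZ n).quasiMeasurePreserving.ae (hC (Fin n)))
    (ae_tendsto_interpolationBias hZ hρ hK hη hE)
    (hν.tendsto_integral_sq_interpolatedNoise hZ hρ hK hv hE)

end Asymptotics

section SimplicialInterpolant

/-- `T` assigns to every finite family of points that affinely spans `ℝ^d` a Delaunay triangulation
of it. -/
def IsDelaunayScheme {d : ℕ}
    (T : ∀ n : ℕ, (Fin n → EuclideanSpace ℝ (Fin d)) → Set (Finset (Fin n))) : Prop :=
  ∀ (n : ℕ) (x : Fin n → EuclideanSpace ℝ (Fin d)),
    affineSpan ℝ (range x) = ⊤ → IsDelaunayTriangulation x (T n x)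

variable {d : ℕ} {T : ∀ n : ℕ, (Fin n → EuclideanSpace ℝ (Fin d)) → Set (Finset (Fin n))}

theorem IsDelaunayScheme.isDelaunayTriangulation (hT : IsDelaunayScheme T) {n : ℕ} (hn : d < n)
    {x : Fin n → EuclideanSpace ℝ (Fin d)} (hx : GeneralPosition x) :
    IsDelaunayTriangulation x (T n x) :=
  hT n x (hx.affineSpan_eq_top (by simpa using hn))

variable [NeZero d] {Ω : Type*} [MeasurableSpace Ω] {P : Measure Ω}
  {ν : Measure (EuclideanSpace ℝ (Fin d) × ℝ)} [IsProbabilityMeasure ν]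
  {Z : ℕ → Ω → EuclideanSpace ℝ (Fin d) × ℝ} {U : Ω → EuclideanSpace ℝ (Fin d)}
  {ρ : Measure (EuclideanSpace ℝ (Fin d))} [ρ.IsAddHaarMeasure]
  {K : Set (EuclideanSpace ℝ (Fin d))} {η v : EuclideanSpace ℝ (Fin d) → ℝ}

theorem ae_sq_etaHat_sub_eq (hZ : ∀ n, MeasurePreserving (sample Z U n) P (sampleLaw (Fin n) ν))
    (hρ : ν.fst = ρ[|K]) (hT : IsDelaunayScheme T) {n : ℕ} (hn : d < n) :
    (fun ω => (etaHat T (fun i ω => (Z i ω).1) (fun i ω => (Z i ω).2) n ω (U ω) - η (U ω)) ^ 2)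
      =ᵐ[P] fun ω => (interpolatedNoise η (fun i : Fin n => Z i ω) (U ω) +
        interpolationBias η (fun i : Fin n => (Z i ω).1) (U ω)) ^ 2 := by
  filter_upwards [ae_generalPosition_sample hZ hρ] with ω hω
  rw [← (hT.isDelaunayTriangulation hn (hω n)).simplicialInterpolant_sub_eq (hω n), etaHat]

theorem IsRegressionModel.integrable_sq_etaHat_sub [IsFiniteMeasure P]
    (hν : IsRegressionModel ν η v)
    (hZ : ∀ n, MeasurePreserving (sample Z U n) P (sampleLaw (Fin n) ν)) (hρ : ν.fst = ρ[|K])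
    (hT : IsDelaunayScheme T) {n : ℕ} (hn : d < n) :
    Integrable (fun ω => (etaHat T (fun i ω => (Z i ω).1) (fun i ω => (Z i ω).2) n ω (U ω) -
      η (U ω)) ^ 2) P :=
  (hν.integrable_sq_error (hZ n)).congr (ae_sq_etaHat_sub_eq hZ hρ hT hn).symm

theorem IsRegressionModel.tendsto_integral_sq_etaHat_sub [IsFiniteMeasure P]
    (hν : IsRegressionModel ν η v)
    (hZ : ∀ n, MeasurePreserving (sample Z U n) P (sampleLaw (Fin n) ν)) (hρ : ν.fst = ρ[|K])
    (hK : Convex ℝ K) (hη : ContinuousOn η (interior K)) (hv : ContinuousOn v (interior K))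
    (hT : IsDelaunayScheme T) :
    Tendsto (fun n => ∫ ω, (etaHat T (fun i ω => (Z i ω).1) (fun i ω => (Z i ω).2) n ω (U ω) -
      η (U ω)) ^ 2 ∂P) atTop (𝓝 (2 / (d + 2) * ∫ a, (a.2 - η a.1) ^ 2 ∂ν)) := by
  have limit := hν.tendsto_integral_sq_error hZ hρ hK hη hv
    ((eventually_gt_atTop d).mono fun n hn x hx z hz =>
      (hT.isDelaunayTriangulation hn hx).exists_isDelaunayWeight hz)
  rw [finrank_euclideanSpace_fin] at limit
  refine limit.congr' ?_
  filter_upwards [eventually_gt_atTop d] with n hn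
  exact (integral_congr_ae (ae_sq_etaHat_sub_eq hZ hρ hT hn)).symm

end SimplicialInterpolant

theorem IsSimplePolytope.convex {d : ℕ} {K : Set (EuclideanSpace ℝ (Fin d))}
    (hK : IsSimplePolytope K) : Convex ℝ K := by
  obtain ⟨V, rfl⟩ := hK.isPolytope
  exact convex_convexHull ℝ _

end SimplicialInterpolation

open SimplicialInterpolation Topology in
theorem mainTheorem6_general {d : ℕ} (hd : 1 ≤ d)
    {Ω : Type*} [MeasurableSpace Ω] (P : Measure Ω) [IsProbabilityMeasure P]
    (X : ℕ → Ω → EuclideanSpace ℝ (Fin d)) (Y : ℕ → Ω → ℝ)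
    (X₀ : Ω → EuclideanSpace ℝ (Fin d)) (Y₀ : Ω → ℝ)
    (hX : ∀ i, Measurable (X i)) (hY : ∀ i, Measurable (Y i))
    (hX₀ : Measurable X₀) (hY₀ : Measurable Y₀)
    (h_ident : ∀ i, IdentDistrib (fun ω => (X i ω, Y i ω)) (fun ω => (X₀ ω, Y₀ ω)) P P)
    (h_indep : iIndepFun (fun i ω => (X i ω, Y i ω)) P)
    (h_test : IndepFun (fun ω i => (X i ω, Y i ω)) (fun ω => (X₀ ω, Y₀ ω)) P)
    (M : ℝ≥0) (h_bound : ∀ᵐ ω ∂P, |Y₀ ω| ≤ M)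
    (K : Set (EuclideanSpace ℝ (Fin d))) (hK : Convex ℝ K) (h_unif : P.map X₀ = volume[|K])
    (η : EuclideanSpace ℝ (Fin d) → ℝ)
    (hη : (fun ω => η (X₀ ω)) =ᵐ[P] condExp (MeasurableSpace.comap X₀ inferInstance) P Y₀)
    (hη_cont : ContinuousOn η (interior K))
    (v : EuclideanSpace ℝ (Fin d) → ℝ)
    (hv : (fun ω => v (X₀ ω)) =ᵐ[P] condVar (MeasurableSpace.comap X₀ inferInstance) Y₀ P)
    (hv_cont : ContinuousOn v (interior K))
    (T : ∀ n : ℕ, (Fin n → EuclideanSpace ℝ (Fin d)) → Set (Finset (Fin n)))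
    (hT : IsDelaunayScheme T) :
    (∀ n, d < n → Integrable (fun ω => (etaHat T X Y n ω (X₀ ω) - η (X₀ ω)) ^ 2) P) ∧
    Tendsto (fun n => ∫ ω, (etaHat T X Y n ω (X₀ ω) - η (X₀ ω)) ^ 2 ∂P) atTop
      (𝓝 (2 / ((d : ℝ) + 2) * ∫ ω, (Y₀ ω - η (X₀ ω)) ^ 2 ∂P)) := by
  have : NeZero d := ⟨by omega⟩
  have hZ₀ : Measurable fun ω => (X₀ ω, Y₀ ω) := hX₀.prodMk hY₀
  have := Measure.isProbabilityMeasure_map (μ := P) hZ₀.aemeasurable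
  have indicator_eq (g : EuclideanSpace ℝ (Fin d) → ℝ) :
      (fun ω => (interior K).indicator g (X₀ ω)) =ᵐ[P] fun ω => g (X₀ ω) :=
    (ae_of_ae_map hX₀.aemeasurable (h_unif ▸ ae_cond_mem_interior hK)).mono
      fun ω h => indicator_of_mem h g
  have hη_meas := measurable_indicator_of_continuousOn hη_cont isOpen_interior.measurableSet
  have hv_meas := measurable_indicator_of_continuousOn hv_cont isOpen_interior.measurableSet
  have model := isRegressionModel_map hX₀ hY₀ h_bound hη_meas hv_meas
    ((indicator_eq η).trans hη) ((indicator_eq v).trans hv)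
  have hZ := measurePreserving_sample (fun i => (hX i).prodMk (hY i)) hZ₀ h_ident h_indep h_test
  have hρ := (Measure.fst_map_prodMk (μ := P) hY₀).trans h_unif
  have error_eq (n : ℕ) := (indicator_eq η).mono fun ω h =>
    congrArg (fun t => (etaHat T X Y n ω (X₀ ω) - t) ^ 2) h
  have noise_eq : ∫ a, (a.2 - (interior K).indicator η a.1) ^ 2 ∂P.map (fun ω => (X₀ ω, Y₀ ω)) =
      ∫ ω, (Y₀ ω - η (X₀ ω)) ^ 2 ∂P := by
    rw [integral_map hZ₀.aemeasurable (by fun_prop)]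
    exact integral_congr_ae ((indicator_eq η).mono fun ω h => congrArg (fun t => (Y₀ ω - t) ^ 2) h)
  have limit := model.tendsto_integral_sq_etaHat_sub hZ hρ hK
    (hη_cont.congr fun x hx => indicator_of_mem hx η)
    (hv_cont.congr fun x hx => indicator_of_mem hx v) hT
  refine ⟨fun n hn => (model.integrable_sq_etaHat_sub hZ hρ hT hn).congr (error_eq n), ?_⟩
  rw [noise_eq] at limit
  exact limit.congr fun n => integral_congr_ae (error_eq n)

theorem mainTheorem6 {d : ℕ} (hd : 1 ≤ d)
    -- the training examples `(X i, Y i)` and the test example `(X₀, Y₀)`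
    {Ω : Type*} [MeasurableSpace Ω] (P : Measure Ω) [IsProbabilityMeasure P]
    (X : ℕ → Ω → EuclideanSpace ℝ (Fin d)) (Y : ℕ → Ω → ℝ)
    (X₀ : Ω → EuclideanSpace ℝ (Fin d)) (Y₀ : Ω → ℝ)
    (hX : ∀ i, Measurable (X i)) (hY : ∀ i, Measurable (Y i))
    (hX₀ : Measurable X₀) (hY₀ : Measurable Y₀)
    (h_ident : ∀ i, IdentDistrib (fun ω => (X i ω, Y i ω)) (fun ω => (X₀ ω, Y₀ ω)) P P)
    (h_indep : iIndepFun (fun i ω => (X i ω, Y i ω)) P)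
    (h_test : IndepFun (fun ω i => (X i ω, Y i ω)) (fun ω => (X₀ ω, Y₀ ω)) P)
    (h_range : ∀ᵐ ω ∂P, Y₀ ω ∈ Set.Icc (0 : ℝ) 1)
    -- the marginal distribution is uniform on a full-dimensional simple polytope
    (K : Set (EuclideanSpace ℝ (Fin d))) (hK : SimplicialInterpolation.IsSimplePolytope K)
    (h_unif : P.map X₀ = ProbabilityTheory.cond volume K)
    -- the conditional mean function and its smoothness
    (η : EuclideanSpace ℝ (Fin d) → ℝ)
    (hη : (fun ω => η (X₀ ω)) =ᵐ[P]
      condExp (MeasurableSpace.comap X₀ inferInstance) P Y₀)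
    (A α : ℝ≥0) (hα : 0 < α) (hη_smooth : HolderOnWith A α η K)
    -- the conditional variance function and its smoothness
    (v : EuclideanSpace ℝ (Fin d) → ℝ)
    (hv : (fun ω => v (X₀ ω)) =ᵐ[P]
      condVar (MeasurableSpace.comap X₀ inferInstance) Y₀ P)
    (A' α' : ℝ≥0) (hα' : 0 < α') (hv_smooth : HolderOnWith A' α' v K)
    -- the Delaunay triangulation scheme
    (T : ∀ n : ℕ, (Fin n → EuclideanSpace ℝ (Fin d)) → Set (Finset (Fin n)))
    (hT : ∀ (n : ℕ) (x : Fin n → EuclideanSpace ℝ (Fin d)),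
      affineSpan ℝ (Set.range x) = ⊤ →
        SimplicialInterpolation.IsDelaunayTriangulation x (T n x)) :
    (∀ n, d < n →
      Integrable (fun ω => (SimplicialInterpolation.etaHat T X Y n ω (X₀ ω) - η (X₀ ω)) ^ 2) P) ∧
    limsup (fun n => ((∫ ω, (SimplicialInterpolation.etaHat T X Y n ω (X₀ ω) - η (X₀ ω)) ^ 2 ∂P : ℝ)
        : EReal)) atTop ≤
      ((2 / ((d : ℝ) + 2) * ∫ ω, (Y₀ ω - η (X₀ ω)) ^ 2 ∂P : ℝ) : EReal) := by
  obtain ⟨integrable, limit⟩ := mainTheorem6_general hd P X Y X₀ Y₀ hX hY hX₀ hY₀ h_ident h_indep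
    h_test 1 (h_range.mono fun ω h => abs_le.2 ⟨by linarith [h.1], h.2⟩) K hK.convex h_unif
    η hη ((hη_smooth.continuousOn hα).mono interior_subset)
    v hv ((hv_smooth.continuousOn hα').mono interior_subset) T hT
  exact ⟨integrable, (EReal.tendsto_coe.2 limit).limsup_eq.le⟩
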